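/- Let $r,T>0$, let $d,m$ be natural numbers, and let $\alpha,\beta,\delta$ be real numbers with $0<\beta,\delta\le 1$ and $0<\alpha<\min\{\tfrac12,\beta,\tfrac{\delta}{1+\delta}\}$. **Spaces.** For $a<c$, $W_0^{\alpha,\infty}(a,c;\mathbb R^d)$ is the space of measurable $f:[a,c]\to\mathbb R^d$ with $$\sup_{t\in[a,c]}\Big(|f(t)|+\int_a^t\frac{|f(t)-f(s)|}{(t-s)^{\alpha+1}}\,ds\Big)<\infty ,$$ and $C^{1-\alpha}(a,c;\mathbb R^d)$ is the space of $(1-\alpha)$-Hölder continuous functions, i.e. those with $\sup_{[a,c]}|f|+\sup_{a\le s<t\le c}|f(t)-f(s)|/(t-s)^{1-\alpha}<\infty$. $C(-r,T;\mathbb R^d)$ is the space of continuous functions $[-r,T]\to\mathbb R^d$ with the supremum norm $\|\cdot\|_{\infty(r)}$ and its Borel $\sigma$-algebra. $W_T^{1-\alpha,\infty}(0,T;\mathbb R^m)$ is the space of measurable $g:[0,T]\to\mathbb R^m$ with $$\sup_{0<s<t<T}\Big(\frac{|g(t)-g(s)|}{(t-s)^{1-\alpha}}+\int_s^t\frac{|g(u)-g(s)|}{(u-s)^{2-\alpha}}\,du\Big)<\infty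 ,$$ and $W_0^{\alpha,1}(0,T)$ is the space of measurable $f:[0,T]\to\mathbb R$ with $\int_0^T\frac{|f(s)|}{s^\alpha}ds+\int_0^T\!\int_0^s\frac{|f(s)-f(u)|}{(s-u)^{\alpha+1}}du\,ds<\infty$. **Integral.** For real-valued $g\in W_T^{1-\alpha,\infty}(0,T)$ and $f\in W_0^{\alpha,1}(0,T)$ the generalized Stieltjes integral is $$\int_0^T f\,dg=(-1)^\alpha\int_0^T D^\alpha_{0+}f(s)\,D^{1-\alpha}_{T-}g_{T-}(s)\,ds,\qquad g_{T-}(s)=g(s)-g(T-),$$ $$D^\alpha_{0+}f(s)=\frac1{\Gamma(1-\alpha)}\Big(\frac{f(s)}{s^\alpha}+\alpha\int_0^s\frac{f(s)-f(u)}{(s-u)^{\alpha+1}}du\Big),$$ $$D^{1-\alpha}_{T-}h(s)=\frac{(-1)^{1-\alpha}}{\Gamma(\alpha)}\Big(\frac{h(s)}{(T-s)^{1-\alpha}}+(1-\alpha)\int_s^T\frac{h(s)-h(u)}{(u-s)^{2-\alpha}}du\Big),$$ with $(-1)^\alpha(-1)^{1-\alpha}=-1$, and $\int_0^t f\,dg=\int_0^T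 f\mathbf 1_{(0,t)}\,dg$. For a $d\times m$ matrix-valued $f$ and an $\mathbb R^m$-valued $g$, $\big(\int_0^t f\,dg\big)_i=\sum_{j=1}^m\int_0^t f_{ij}\,dg^j$. **(H1)** $\sigma:[0,T]\times\mathbb R^d\to\mathbb R^{d\times m}$ is measurable, $\sigma(t,x)$ is differentiable in $x$, and for every $N\ge0$ there is $M_N>0$ such that, for all $s,t\in[0,T]$ and $i=1,\dots,d$: (1) $|\sigma(t,x)-\sigma(t,y)|\le M_0|x-y|$ for all $x,y\in\mathbb R^d$; (2) $|\partial_{x_i}\sigma(t,x)-\partial_{x_i}\sigma(t,y)|\le M_N|x-y|^\delta$ for all $|x|,|y|\le N$; (3) $|\sigma(t,x)-\sigma(s,x)|+|\partial_{x_i}\sigma(t,x)-\partial_{x_i}\sigma(s,x)|\le M_0|t-s|^\beta$ for all $x\in\mathbb R^d$. **(H2) with $\rho=1/\alpha$.** $b:[0,T]\times C(-r,T;\mathbb R^d)\to\mathbb R^d$ is measurable; for $t\in(0,T]$, $b(t,f)$ depends only on $\{f(s):-r\le s\le t\}$; and there is $b_0\in L^{1/\alpha}(0,T;\mathbb R)$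 and for every $N\ge0$ there is $L_N>0$ such that, for all $t\in[0,T]$: (1) $|b(t,x)-b(t,y)|\le L_N\sup_{-r\le s\le t}|x(s)-y(s)|$ whenever $\|x\|_{\infty(r)},\|y\|_{\infty(r)}\le N$; (2) $|b(t,x)|\le L_0\sup_{-r\le s\le t}|x(s)|+b_0(t)$ for all $x\in C(-r,T;\mathbb R^d)$. **Theorem.** Assume (H1) and (H2) with $\rho=1/\alpha$, let $g\in W_T^{1-\alpha,\infty}(0,T;\mathbb R^m)$ and $\eta\in W_0^{\alpha,\infty}(-r,0;\mathbb R^d)\cap C^{1-\alpha}(-r,0;\mathbb R^d)$. Then the delay equation $$x(t)=\eta(0)+\int_0^t b(s,x)\,ds+\int_0^t\sigma(s,x(s-r))\,dg_s,\quad t\in(0,T],\qquad x(t)=\eta(t),\quad t\in[-r,0],$$ has a unique solution $x\in W_0^{\alpha,\infty}(-r,T;\mathbb R^d)\cap C^{1-\alpha}(-r,T;\mathbb R^d)$. (Being a solution includes that the integrals exist: $s\mapsto b(s,x)$ is integrable on $[0,T]$, and the entries of $s\mapsto\sigma(s,x(s-r))\mathbf 1_{(0,t)}(s)$ are in $W_0^{\alpha,1}(0,T)$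 for every $t\in(0,T]$.) -/

import Mathlib

noncomputable section

namespace DelayEq

open MeasureTheory Set
open scoped ENNReal

/-- The norm `sup_{t ∈ [a,b]} ( |f(t)| + ∫_a^t |f(t) - f(s)| / (t-s)^{α+1} ds )`, with values in
`[0,∞]`, of a function on `[a,b]` (only the values of `f` on `[a,b]` matter). -/
def eNormW {E : Type*} [NormedAddCommGroup E] (α a b : ℝ) (f : ℝ → E) : ℝ≥0∞ :=
  ⨆ t ∈ Icc a b,
    (‖f t‖ₑ + ∫⁻ s in Ioo a t, ‖f t - f s‖ₑ / ENNReal.ofReal ((t - s) ^ (α + 1)))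

/-- The space `W_0^{α,∞}(a,b;E)`. -/
def MemW {E : Type*} [NormedAddCommGroup E] [MeasurableSpace E]
    (α a b : ℝ) (f : ℝ → E) : Prop :=
  (Measurable fun t : Icc a b => f t) ∧ eNormW α a b f < ∞

/-- The Hölder norm `sup_{[a,b]} |f| + sup_{a ≤ s < t ≤ b} |f(t) - f(s)| / (t-s)^μ`. -/
def eNormHolder {E : Type*} [NormedAddCommGroup E] (μ a b : ℝ) (f : ℝ → E) : ℝ≥0∞ :=
  (⨆ t ∈ Icc a b, ‖f t‖ₑ) +
    ⨆ s ∈ Icc a b, ⨆ t ∈ Ioc s b, ‖f t - f s‖ₑ / ENNReal.ofReal ((t - s) ^ μ)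

/-- The space `C^μ(a,b;E)`. -/
def MemHolder {E : Type*} [NormedAddCommGroup E] (μ a b : ℝ) (f : ℝ → E) : Prop :=
  eNormHolder μ a b f < ∞

/-- The seminorm
`sup_{0<s<t<T} ( |g(t) - g(s)| / (t-s)^{1-α} + ∫_s^t |g(u) - g(s)| / (u-s)^{2-α} du )`. -/
def eNormWT {E : Type*} [NormedAddCommGroup E] (α T : ℝ) (g : ℝ → E) : ℝ≥0∞ :=
  ⨆ s ∈ Ioo 0 T, ⨆ t ∈ Ioo s T,
    (‖g t - g s‖ₑ / ENNReal.ofReal ((t - s) ^ (1 - α)) +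
      ∫⁻ u in Ioo s t, ‖g u - g s‖ₑ / ENNReal.ofReal ((u - s) ^ (2 - α)))

/-- The space `W_T^{1-α,∞}(0,T;E)`. -/
def MemWT {E : Type*} [NormedAddCommGroup E] [MeasurableSpace E]
    (α T : ℝ) (g : ℝ → E) : Prop :=
  (Measurable fun t : Icc 0 T => g t) ∧ eNormWT α T g < ∞

/-- The norm `∫_0^T |f(s)| / s^α ds + ∫_0^T ∫_0^s |f(s) - f(u)| / (s-u)^{α+1} du ds`. -/
def eNormW1 (α T : ℝ) (f : ℝ → ℝ) : ℝ≥0∞ :=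
  (∫⁻ s in Ioo 0 T, ‖f s‖ₑ / ENNReal.ofReal (s ^ α)) +
    ∫⁻ s in Ioo 0 T, ∫⁻ u in Ioo 0 s, ‖f s - f u‖ₑ / ENNReal.ofReal ((s - u) ^ (α + 1))

/-- The space `W_0^{α,1}(0,T)`. -/
def MemW1 (α T : ℝ) (f : ℝ → ℝ) : Prop :=
  (Measurable fun t : Icc 0 T => f t) ∧ eNormW1 α T f < ∞

/-- The Weyl derivative `D^α_{0+} f`. -/
def weylLeft (α : ℝ) (f : ℝ → ℝ) (x : ℝ) : ℝ :=
  1 / Real.Gamma (1 - α) *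
    (f x / x ^ α + α * ∫ y in (0 : ℝ)..x, (f x - f y) / (x - y) ^ (α + 1))

/-- The Weyl derivative `D^γ_{T-} g`, without its conventional factor `(-1)^γ`. -/
def weylRight (γ T : ℝ) (g : ℝ → ℝ) (x : ℝ) : ℝ :=
  1 / Real.Gamma (1 - γ) *
    (g x / (T - x) ^ γ + γ * ∫ y in x..T, (g x - g y) / (y - x) ^ (γ + 1))

/-- The generalized Stieltjes integral
`∫_0^T f dg = (-1)^α ∫_0^T D^α_{0+} f (s) D^{1-α}_{T-} g_{T-} (s) ds`, where
`g_{T-}(s) = g(s) - g(T-)`. The factors `(-1)^α` and `(-1)^{1-α}` multiply to `-1`. -/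
def stieltjes (α T : ℝ) (f g : ℝ → ℝ) : ℝ :=
  -∫ s in (0 : ℝ)..T,
    weylLeft α f s * weylRight (1 - α) T (fun u => g u - Function.leftLim g T) s

/-- The indefinite integral `∫_0^t f dg = ∫_0^T f 1_{(0,t)} dg`. -/
def stieltjesTo (α T : ℝ) (f g : ℝ → ℝ) (t : ℝ) : ℝ :=
  stieltjes α T ((Ioo 0 t).indicator f) g

/-- Hypothesis (H1). A `d × m` matrix is an element of `EuclideanSpace ℝ (Fin d × Fin m)`, and
`∂_{x_i} σ(t,x)` is the derivative in the direction of the `i`-th basis vector. -/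
structure HypH1 {d m : ℕ} (T β δ : ℝ)
    (σ : ℝ → EuclideanSpace ℝ (Fin d) → EuclideanSpace ℝ (Fin d × Fin m)) : Prop where
  beta_mem : β ∈ Ioc 0 1
  delta_mem : δ ∈ Ioc 0 1
  measurable : Measurable fun p : Icc 0 T × EuclideanSpace ℝ (Fin d) => σ p.1 p.2
  differentiable : ∀ t ∈ Icc 0 T, Differentiable ℝ (σ t)
  bounds : ∃ M : ℝ → ℝ, (∀ N, 0 ≤ N → 0 < M N) ∧
    (∀ t ∈ Icc 0 T, ∀ x y, ‖σ t x - σ t y‖ ≤ M 0 * ‖x - y‖) ∧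
    (∀ N, 0 ≤ N → ∀ t ∈ Icc 0 T, ∀ x y, ‖x‖ ≤ N → ‖y‖ ≤ N → ∀ i : Fin d,
      ‖fderiv ℝ (σ t) x (EuclideanSpace.single i 1) -
        fderiv ℝ (σ t) y (EuclideanSpace.single i 1)‖ ≤ M N * ‖x - y‖ ^ δ) ∧
    (∀ t ∈ Icc 0 T, ∀ s ∈ Icc 0 T, ∀ x, ∀ i : Fin d,
      ‖σ t x - σ s x‖ +
        ‖fderiv ℝ (σ t) x (EuclideanSpace.single i 1) -
          fderiv ℝ (σ s) x (EuclideanSpace.single i 1)‖ ≤ M 0 * |t - s| ^ β)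

/-- `sup_{a ≤ s ≤ t} |z(s)|` for a continuous path `z` on `[a,b]` and `t ∈ [a,b]`. -/
def supUpTo {E : Type*} [NormedAddCommGroup E] {a b : ℝ} (t : ℝ) (z : C(Icc a b, E)) : ℝ :=
  ⨆ s : {s : Icc a b // (s : ℝ) ≤ t}, ‖z s‖

/-- Hypothesis (H2). The norm of `C(Icc (-r) T, _)` is the supremum norm, its σ-algebra is the
Borel one. -/
structure HypH2 {d : ℕ} (r T ρ : ℝ)
    (b : ℝ → C(Icc (-r) T, EuclideanSpace ℝ (Fin d)) → EuclideanSpace ℝ (Fin d)) : Prop where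
  two_le : 2 ≤ ρ
  measurable : Measurable[@Prod.instMeasurableSpace _ _ _ (borel _)]
    fun p : Icc 0 T × C(Icc (-r) T, EuclideanSpace ℝ (Fin d)) => b p.1 p.2
  causal : ∀ t ∈ Ioc 0 T, ∀ x y : C(Icc (-r) T, EuclideanSpace ℝ (Fin d)),
    (∀ s : Icc (-r) T, (s : ℝ) ≤ t → x s = y s) → b t x = b t y
  bounds : ∃ (b₀ : ℝ → ℝ) (L : ℝ → ℝ),
    MemLp b₀ (ENNReal.ofReal ρ) (volume.restrict (Icc 0 T)) ∧
    (∀ N, 0 ≤ N → 0 < L N) ∧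
    (∀ N, 0 ≤ N → ∀ t ∈ Icc 0 T, ∀ x y : C(Icc (-r) T, EuclideanSpace ℝ (Fin d)),
      ‖x‖ ≤ N → ‖y‖ ≤ N → ‖b t x - b t y‖ ≤ L N * supUpTo t (x - y)) ∧
    (∀ t ∈ Icc 0 T, ∀ x : C(Icc (-r) T, EuclideanSpace ℝ (Fin d)),
      ‖b t x‖ ≤ L 0 * supUpTo t x + b₀ t)

/-- `x` solves `x(t) = η(0) + ∫_0^t b(s,x) ds + ∫_0^t σ(s,x(s-r)) dg_s` for `t ∈ (0,T]`,
`x(t) = η(t)` for `t ∈ [-r,0]`. The first two fields say that the integrals exist. The path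
`x : [-r,T] → ℝ^d` is evaluated at real times through `Set.IccExtend`; only times in `[-r,T]`
matter. -/
structure IsSolution {d m : ℕ} {r T : ℝ} (h : -r ≤ T) (α : ℝ)
    (b : ℝ → C(Icc (-r) T, EuclideanSpace ℝ (Fin d)) → EuclideanSpace ℝ (Fin d))
    (σ : ℝ → EuclideanSpace ℝ (Fin d) → EuclideanSpace ℝ (Fin d × Fin m))
    (g : ℝ → EuclideanSpace ℝ (Fin m)) (η : ℝ → EuclideanSpace ℝ (Fin d))
    (x : C(Icc (-r) T, EuclideanSpace ℝ (Fin d))) : Prop where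
  integrable_drift : IntegrableOn (fun s => b s x) (Icc 0 T)
  memW1_diffusion : ∀ t ∈ Ioc 0 T, ∀ (i : Fin d) (j : Fin m),
    MemW1 α T ((Ioo 0 t).indicator fun s => σ s (IccExtend h x (s - r)) (i, j))
  equation : ∀ t ∈ Ioc 0 T, IccExtend h x t = η 0 + (∫ s in (0 : ℝ)..t, b s x) +
    WithLp.toLp 2 fun i => ∑ j : Fin m,
      stieltjesTo α T (fun s => σ s (IccExtend h x (s - r)) (i, j)) (fun s => g s j) t
  initial : ∀ t ∈ Icc (-r) 0, IccExtend h x t = η t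

end DelayEq

end

/-! If `x` is `(1-α)`-Hölder then `s ↦ σ(s, x(s-r))` is Hölder of exponent `min(β, 1-α) > α`, so
its truncation to `[s,t)` has `W_0^{α,1}` norm `O((t-s)^{1-α})`: the jumps contribute
`∫∫ |u-v|^{-α-1}` over pairs separated by an endpoint. Since the right Weyl derivative of `g` is
bounded, the Stieltjes integral is again `(1-α)`-Hölder in its upper limit; so is the drift
integral, by Hölder's inequality with exponent `1/α`.

On `[-r, τ+r]` the diffusion term involves `x` only on `[-r, τ]`. Once `x` is known up to `τ`, the
equation up to `τ + r` is therefore an equation `x = z + ∫ b(s,x) ds` with known forcing `z`, which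
Picard iteration with factorially decreasing constants solves uniquely. Existence and uniqueness
follow by induction on the number of delays.
-/

noncomputable section

namespace DelayEq

open Filter MeasureTheory Set
open scoped ENNReal NNReal Topology

/-! ### Integrals of powers -/

lemma div_ofReal_rpow (a : ℝ≥0∞) {u : ℝ} (hu : 0 < u) (q : ℝ) :
    a / ENNReal.ofReal (u ^ q) = a * ENNReal.ofReal (u ^ (-q)) := by
  rw [div_eq_mul_inv, ← ENNReal.ofReal_inv_of_pos (Real.rpow_pos_of_pos hu q),
    Real.rpow_neg hu.le]

lemma ofReal_mul_div_rpow (C : ℝ≥0∞) {u : ℝ} (hu : 0 < u) (p q : ℝ) :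
    C * ENNReal.ofReal (u ^ p) / ENNReal.ofReal (u ^ q) = C * ENNReal.ofReal (u ^ (p - q)) := by
  rw [div_ofReal_rpow _ hu, mul_assoc, ← ENNReal.ofReal_mul (Real.rpow_nonneg hu.le _),
    ← Real.rpow_add hu, sub_eq_add_neg]

lemma setLIntegral_Ioo_zero_rpow {p c : ℝ} (hp : -1 < p) (hc : 0 ≤ c) :
    ∫⁻ u in Ioo 0 c, ENNReal.ofReal (u ^ p) = ENNReal.ofReal (c ^ (p + 1) / (p + 1)) := by
  have hint : IntegrableOn (fun u : ℝ => u ^ p) (Ioo 0 c) :=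
    (intervalIntegrable_iff_integrableOn_Ioo_of_le hc).1
      (intervalIntegral.intervalIntegrable_rpow' hp)
  rw [← ofReal_integral_eq_lintegral_ofReal hint, ← integral_Ioc_eq_integral_Ioo,
    ← intervalIntegral.integral_of_le hc, integral_rpow (Or.inl hp),
    Real.zero_rpow (by linarith), sub_zero]
  exact ae_restrict_of_forall_mem measurableSet_Ioo fun u hu => Real.rpow_nonneg hu.1.le p

lemma setLIntegral_Ioi_rpow {p c : ℝ} (hp : p < -1) (hc : 0 < c) :
    ∫⁻ u in Ioi c, ENNReal.ofReal (u ^ p) = ENNReal.ofReal (-c ^ (p + 1) / (p + 1)) := by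
  rw [← ofReal_integral_eq_lintegral_ofReal (integrableOn_Ioi_rpow_of_lt hp hc),
    integral_Ioi_rpow_of_lt hp hc]
  exact ae_restrict_of_forall_mem measurableSet_Ioi fun u hu =>
    Real.rpow_nonneg (hc.trans hu).le p

lemma setLIntegral_comp_sub_right (F : ℝ → ℝ≥0∞) (c : ℝ) (S : Set ℝ) :
    ∫⁻ x in (· - c) ⁻¹' S, F (x - c) = ∫⁻ u in S, F u :=
  (measurePreserving_sub_right volume c).setLIntegral_comp_preimage_emb
    (MeasurableEquiv.subRight c).measurableEmbedding F S

lemma setLIntegral_comp_sub_left (F : ℝ → ℝ≥0∞) (c : ℝ) (S : Set ℝ) :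
    ∫⁻ x in (c - ·) ⁻¹' S, F (c - x) = ∫⁻ u in S, F u :=
  (volume.measurePreserving_sub_left c).setLIntegral_comp_preimage_emb
    (MeasurableEquiv.subLeft c).measurableEmbedding F S

lemma setLIntegral_Ioo_sub_right_rpow {p s t : ℝ} (hp : -1 < p) (hst : s ≤ t) :
    ∫⁻ x in Ioo s t, ENNReal.ofReal ((x - s) ^ p) =
      ENNReal.ofReal ((t - s) ^ (p + 1) / (p + 1)) := by
  have h := setLIntegral_comp_sub_right (fun u => ENNReal.ofReal (u ^ p)) s (Ioo 0 (t - s))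
  rwa [preimage_sub_const_Ioo, zero_add, sub_add_cancel,
    setLIntegral_Ioo_zero_rpow hp (sub_nonneg.2 hst)] at h

lemma setLIntegral_Ioo_sub_left_rpow {p s t : ℝ} (hp : -1 < p) (hst : s ≤ t) :
    ∫⁻ x in Ioo s t, ENNReal.ofReal ((t - x) ^ p) =
      ENNReal.ofReal ((t - s) ^ (p + 1) / (p + 1)) := by
  have h := setLIntegral_comp_sub_left (fun u => ENNReal.ofReal (u ^ p)) t (Ioo 0 (t - s))
  rwa [preimage_const_sub_Ioo, sub_sub_cancel, sub_zero,
    setLIntegral_Ioo_zero_rpow hp (sub_nonneg.2 hst)] at h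

lemma setLIntegral_Ioi_sub_right_rpow {p t y : ℝ} (hp : p < -1) (hy : y < t) :
    ∫⁻ x in Ioi t, ENNReal.ofReal ((x - y) ^ p) =
      ENNReal.ofReal (-(t - y) ^ (p + 1) / (p + 1)) := by
  have h := setLIntegral_comp_sub_right (fun u => ENNReal.ofReal (u ^ p)) y (Ioi (t - y))
  rwa [preimage_sub_const_Ioi, sub_add_cancel, setLIntegral_Ioi_rpow hp (sub_pos.2 hy)] at h

lemma setLIntegral_Iio_sub_left_rpow {p s x : ℝ} (hp : p < -1) (hx : s < x) :
    ∫⁻ y in Iio s, ENNReal.ofReal ((x - y) ^ p) =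
      ENNReal.ofReal (-(x - s) ^ (p + 1) / (p + 1)) := by
  have h := setLIntegral_comp_sub_left (fun u => ENNReal.ofReal (u ^ p)) x (Ioi (x - s))
  rwa [preimage_const_sub_Ioi, sub_sub_cancel, setLIntegral_Ioi_rpow hp (sub_pos.2 hx)] at h

/-! ### Hölder continuity -/

section Holder

variable {X Y Z : Type*} [PseudoEMetricSpace X] [PseudoEMetricSpace Y] [PseudoEMetricSpace Z]
  {E : Type*} [NormedAddCommGroup E]

/-- Hölder continuity on `S` with an unspecified constant. The exponent is real, as in the
function spaces of the theorem; a negative one is read as `0`. -/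
def HolderOn (μ : ℝ) (f : X → Y) (S : Set X) : Prop :=
  ∃ C : ℝ≥0, HolderOnWith C μ.toNNReal f S

lemma HolderOn.congr {μ : ℝ} {f g : X → Y} {S : Set X} (hf : HolderOn μ f S) (h : EqOn g f S) :
    HolderOn μ g S :=
  hf.imp fun _ hC x hx y hy => by rw [h hx, h hy]; exact hC x hx y hy

lemma HolderOn.continuousOn {μ : ℝ} (hμ : 0 < μ) {f : X → Y} {S : Set X} (hf : HolderOn μ f S) :
    ContinuousOn f S :=
  hf.elim fun _ hC => hC.continuousOn (Real.toNNReal_pos.2 hμ)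

lemma HolderOn.uniformContinuousOn {μ : ℝ} (hμ : 0 < μ) {f : X → Y} {S : Set X}
    (hf : HolderOn μ f S) : UniformContinuousOn f S :=
  hf.elim fun _ hC => hC.uniformContinuousOn (Real.toNNReal_pos.2 hμ)

lemma HolderOn.comp_lipschitz {μ : ℝ} {f : Y → Z} {S : Set Y} (hf : HolderOn μ f S) {K : ℝ≥0}
    {φ : X → Y} {S' : Set X} (hφ : LipschitzOnWith K φ S') (h : MapsTo φ S' S) :
    HolderOn μ (f ∘ φ) S' := by
  obtain ⟨C, hC⟩ := hf
  have := hC.comp (holderOnWith_one.2 hφ) h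
  rw [mul_one] at this
  exact ⟨_, this⟩

lemma HolderOn.lipschitz_comp {μ : ℝ} {K : ℝ≥0} {φ : Y → Z} {S' : Set Y}
    (hφ : LipschitzOnWith K φ S') {f : X → Y} {S : Set X} (hf : HolderOn μ f S)
    (h : MapsTo f S S') : HolderOn μ (φ ∘ f) S := by
  obtain ⟨C, hC⟩ := hf
  have := (holderOnWith_one.2 hφ).comp hC h
  rw [one_mul] at this
  exact ⟨_, this⟩

lemma HolderOn.of_le {X : Type*} [PseudoMetricSpace X] {μ ν : ℝ} {f : X → Y} {S : Set X}
    (hf : HolderOn μ f S) (hS : Bornology.IsBounded S) (h : ν ≤ μ) : HolderOn ν f S := by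
  obtain ⟨C, hC⟩ := hf
  obtain ⟨D, hD⟩ := Metric.isBounded_iff_nndist.1 hS
  exact ⟨_, hC.of_le (D := D) (fun x hx y hy => by
    rw [edist_nndist]; exact_mod_cast hD hx hy) (Real.toNNReal_le_toNNReal h)⟩

lemma HolderOn.add {X : Type*} [PseudoMetricSpace X] {μ : ℝ} {f g : X → E} {S : Set X}
    (hf : HolderOn μ f S) (hg : HolderOn μ g S) : HolderOn μ (f + g) S := by
  obtain ⟨C, hC⟩ := hf
  obtain ⟨D, hD⟩ := hg
  exact ⟨C + D, HolderWith.restrict_iff.1 ((HolderWith.restrict_iff.2 hC).add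
    (HolderWith.restrict_iff.2 hD))⟩

lemma holderOn_iff {μ : ℝ} (hμ : 0 ≤ μ) {f : ℝ → E} {S : Set ℝ} :
    HolderOn μ f S ↔ ∃ C : ℝ≥0, ∀ s ∈ S, ∀ t ∈ S, s < t →
      ‖f t - f s‖ₑ ≤ C * ENNReal.ofReal ((t - s) ^ μ) := by
  have key : ∀ C : ℝ≥0, ∀ s t, s < t → (‖f t - f s‖ₑ ≤ C * ENNReal.ofReal ((t - s) ^ μ) ↔
      edist (f t) (f s) ≤ C * edist t s ^ (μ.toNNReal : ℝ)) := fun C s t hst => by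
    rw [edist_eq_enorm_sub, edist_dist, Real.dist_eq, abs_of_pos (sub_pos.2 hst),
      Real.coe_toNNReal _ hμ, ENNReal.ofReal_rpow_of_pos (sub_pos.2 hst)]
  refine exists_congr fun C => ⟨fun h s hs t ht hst => ?_, fun h s hs t ht => ?_⟩
  · exact (key C s t hst).2 (h t ht s hs)
  · rcases lt_trichotomy s t with hst | rfl | hst
    · rw [edist_comm, edist_comm s]
      exact (key C s t hst).1 (h s hs t ht hst)
    · simp
    · exact (key C t s hst).1 (h t ht s hs hst)

lemma exists_enorm_le_of_continuousOn {X : Type*} [TopologicalSpace X] {f : X → E} {S : Set X}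
    (hS : IsCompact S) (hf : ContinuousOn f S) : ∃ B : ℝ≥0, ∀ x ∈ S, ‖f x‖ₑ ≤ B := by
  obtain ⟨B, hB⟩ := hS.exists_bound_of_continuousOn hf
  exact ⟨B.toNNReal, fun x hx => by
    rw [← ofReal_norm]; exact ENNReal.ofReal_le_ofReal (hB x hx)⟩

lemma memHolder_iff {μ a b : ℝ} (hμ : 0 < μ) {f : ℝ → E} :
    MemHolder μ a b f ↔ HolderOn μ f (Icc a b) := by
  rw [MemHolder, eNormHolder, ENNReal.add_lt_top, holderOn_iff hμ.le]
  have hdiv : ∀ {C : ℝ≥0∞} {s t : ℝ}, s < t → (‖f t - f s‖ₑ / ENNReal.ofReal ((t - s) ^ μ) ≤ C ↔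
      ‖f t - f s‖ₑ ≤ C * ENNReal.ofReal ((t - s) ^ μ)) := fun hst =>
    ENNReal.div_le_iff
      (ENNReal.ofReal_pos.2 (Real.rpow_pos_of_pos (sub_pos.2 hst) μ)).ne' ENNReal.ofReal_ne_top
  constructor
  · rintro ⟨-, h⟩
    lift (⨆ s ∈ Icc a b, ⨆ t ∈ Ioc s b, ‖f t - f s‖ₑ / ENNReal.ofReal ((t - s) ^ μ)) to ℝ≥0
      using h.ne with C hC
    refine ⟨C, fun s hs t ht hst => (hdiv hst).1 ?_⟩
    rw [hC]
    exact le_iSup₂_of_le s hs (le_iSup₂_of_le t ⟨hst, ht.2⟩ le_rfl)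
  · rintro ⟨C, hC⟩
    have hcont : ContinuousOn f (Icc a b) :=
      ((holderOn_iff hμ.le).2 ⟨C, hC⟩).continuousOn hμ
    obtain ⟨B, hB⟩ := exists_enorm_le_of_continuousOn isCompact_Icc hcont
    exact ⟨(iSup₂_le hB).trans_lt ENNReal.coe_lt_top,
      (iSup₂_le fun s hs => iSup₂_le fun t ht => (hdiv ht.1).2
        (hC s hs t ⟨hs.1.trans ht.1.le, ht.2⟩ ht.1)).trans_lt ENNReal.coe_lt_top⟩

/-- The inner integral `∫_a^t |f(t) - f(s)| / (t-s)^{α+1} ds` shared by the norms of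
`W_0^{α,∞}` and `W_0^{α,1}`. -/
def leftIncrement (α a : ℝ) (f : ℝ → E) (t : ℝ) : ℝ≥0∞ :=
  ∫⁻ s in Ioo a t, ‖f t - f s‖ₑ / ENNReal.ofReal ((t - s) ^ (α + 1))

lemma leftIncrement_le {α μ a t : ℝ} (h : α < μ) (hat : a ≤ t) {f : ℝ → E} {C : ℝ≥0}
    (hC : ∀ s ∈ Ioo a t, ‖f t - f s‖ₑ ≤ C * ENNReal.ofReal ((t - s) ^ μ)) :
    leftIncrement α a f t ≤ C * ENNReal.ofReal ((t - a) ^ (μ - α) / (μ - α)) := by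
  calc leftIncrement α a f t
      ≤ ∫⁻ s in Ioo a t, C * ENNReal.ofReal ((t - s) ^ (μ - (α + 1))) := by
        refine setLIntegral_mono' measurableSet_Ioo fun s hs => ?_
        rw [← ofReal_mul_div_rpow _ (sub_pos.2 hs.2)]
        gcongr
        exact hC s hs
    _ = _ := by
        rw [lintegral_const_mul' _ _ ENNReal.coe_ne_top,
          setLIntegral_Ioo_sub_left_rpow (by linarith) hat]
        congr 3 <;> ring_nf

lemma HolderOn.exists_leftIncrement_le {α μ a b : ℝ} (hα : 0 ≤ α) (h : α < μ) {f : ℝ → E}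
    (hf : HolderOn μ f (Icc a b)) :
    ∃ B : ℝ≥0, ∀ t ∈ Icc a b, leftIncrement α a f t ≤ B := by
  obtain ⟨C, hC⟩ := (holderOn_iff (hα.trans h.le)).1 hf
  refine ⟨C * ((b - a) ^ (μ - α) / (μ - α)).toNNReal, fun t ht =>
    (leftIncrement_le h ht.1 fun s hs =>
      hC s ⟨hs.1.le, hs.2.le.trans ht.2⟩ t ht hs.2).trans ?_⟩
  have := sub_nonneg.2 ht.1
  have := sub_pos.2 h
  push_cast
  gcongr
  exact ENNReal.ofReal_le_ofReal (by gcongr; exact ht.2)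

lemma HolderOn.memW [MeasurableSpace E] [BorelSpace E] {α μ a b : ℝ} (hα : 0 ≤ α) (h : α < μ)
    {f : ℝ → E} (hf : HolderOn μ f (Icc a b)) : MemW α a b f := by
  have hcont := hf.continuousOn (hα.trans_lt h)
  obtain ⟨B, hB⟩ := hf.exists_leftIncrement_le hα h
  obtain ⟨K, hK⟩ := exists_enorm_le_of_continuousOn isCompact_Icc hcont
  exact ⟨(continuousOn_iff_continuous_domRestrict.1 hcont).measurable,
    (iSup₂_le fun t ht => add_le_add (hK t ht) (hB t ht)).trans_lt
      (ENNReal.add_lt_top.2 ⟨ENNReal.coe_lt_top, ENNReal.coe_lt_top⟩)⟩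

end Holder

/-! ### The `W_0^{α,1}` norm of a truncated Hölder function -/

section Truncation

variable {α : ℝ}

lemma leftIncrement_indicator_le {E : Type*} [NormedAddCommGroup E] {f : ℝ → E} {S : Set ℝ}
    (hS : MeasurableSet S) {a x : ℝ} {K : ℝ≥0} (hK : ∀ y ∈ Ioo a x, ‖f y‖ₑ ≤ K) :
    leftIncrement α a (S.indicator f) x ≤ S.indicator (leftIncrement α a f) x +
      K * leftIncrement α a (S.indicator (1 : ℝ → ℝ)) x := by
  have product_rule : ∀ y, ‖S.indicator f x - S.indicator f y‖ₑ ≤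
      S.indicator (fun x => ‖f x - f y‖ₑ) x +
        ‖f y‖ₑ * ‖S.indicator (1 : ℝ → ℝ) x - S.indicator (1 : ℝ → ℝ) y‖ₑ := fun y => by
    have triangle : ‖f x‖ₑ ≤ ‖f x - f y‖ₑ + ‖f y‖ₑ := by
      simpa only [sub_add_cancel] using enorm_add_le (f x - f y) (f y)
    by_cases hx : x ∈ S <;> by_cases hy : y ∈ S <;> simp [hx, hy, triangle]
  have hS_inner : S.indicator (leftIncrement α a f) x = ∫⁻ y in Ioo a x,
      S.indicator (fun x => ‖f x - f y‖ₑ) x / ENNReal.ofReal ((x - y) ^ (α + 1)) := by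
    by_cases hx : x ∈ S <;> simp [hx, leftIncrement]
  rw [hS_inner, leftIncrement, leftIncrement, ← lintegral_const_mul' _ _ ENNReal.coe_ne_top,
    ← lintegral_add_right]
  · refine setLIntegral_mono' measurableSet_Ioo fun y hy => ?_
    rw [← mul_div_assoc, ← ENNReal.add_div]
    gcongr
    exact (product_rule y).trans (by gcongr; exact hK y hy)
  · have : Measurable (S.indicator (1 : ℝ → ℝ)) := measurable_one.indicator hS
    fun_prop

lemma leftIncrement_indicator_one_le {a s t x : ℝ} :
    leftIncrement α a ((Ico s t).indicator (1 : ℝ → ℝ)) x ≤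
      (Ico s t).indicator (fun x => ∫⁻ y in Iio s, ENNReal.ofReal ((x - y) ^ (-(α + 1)))) x +
        (Ici t).indicator
          (fun x => ∫⁻ y in Ico s t, ENNReal.ofReal ((x - y) ^ (-(α + 1)))) x := by
  -- Only those `y` contribute that are separated from `x` by an endpoint of `[s,t)`.
  have separated : ∀ U : Set ℝ, MeasurableSet U →
      (∀ y < x, y ∉ U → (y ∈ Ico s t ↔ x ∈ Ico s t)) →
      leftIncrement α a ((Ico s t).indicator (1 : ℝ → ℝ)) x ≤
        ∫⁻ y in U, ENNReal.ofReal ((x - y) ^ (-(α + 1))) := fun U hU hsep => by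
    rw [← lintegral_indicator hU]
    refine (setLIntegral_mono' measurableSet_Ioo fun y hy => ?_).trans
      (setLIntegral_le_lintegral (Ioo a x) _)
    rw [div_ofReal_rpow _ (sub_pos.2 hy.2)]
    by_cases hyU : y ∈ U
    · rw [indicator_of_mem hyU]
      refine mul_le_of_le_one_left' ?_
      by_cases hx : x ∈ Ico s t <;> by_cases hy' : y ∈ Ico s t <;> simp [hx, hy']
    · have h := hsep y hy.2 hyU
      by_cases hx : x ∈ Ico s t <;> simp [hx, h]
  rcases lt_or_ge x s with hxs | hsx
  · exact (separated ∅ .empty fun y hy _ => by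
      simp only [mem_Ico, hxs.not_ge, (hy.trans hxs).not_ge, false_and]).trans (by simp)
  rcases lt_or_ge x t with hxt | htx
  · rw [indicator_of_mem (show x ∈ Ico s t from ⟨hsx, hxt⟩)]
    refine (separated (Iio s) measurableSet_Iio fun y hy hys => ?_).trans le_self_add
    exact iff_of_true ⟨not_lt.1 hys, hy.trans hxt⟩ ⟨hsx, hxt⟩
  · rw [indicator_of_mem (show x ∈ Ici t from htx)]
    refine (separated (Ico s t) measurableSet_Ico fun y _ hy => ?_).trans le_add_self
    exact iff_of_false hy fun hx => htx.not_gt hx.2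

lemma lintegral_lintegral_Iio_rpow {s t : ℝ} (hα : 0 < α) (hα1 : α < 1) (hst : s ≤ t) :
    ∫⁻ x in Ico s t, ∫⁻ y in Iio s, ENNReal.ofReal ((x - y) ^ (-(α + 1))) =
      ENNReal.ofReal (1 / (α * (1 - α))) * ENNReal.ofReal ((t - s) ^ (1 - α)) := by
  have inner : ∀ x ∈ Ioo s t, ∫⁻ y in Iio s, ENNReal.ofReal ((x - y) ^ (-(α + 1))) =
      ENNReal.ofReal (1 / α) * ENNReal.ofReal ((x - s) ^ (-α)) := fun x hx => by
    rw [setLIntegral_Iio_sub_left_rpow (by linarith) hx.1, ← ENNReal.ofReal_mul (by positivity)]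
    congr 1; ring_nf
  rw [← restrict_Ioo_eq_restrict_Ico, setLIntegral_congr_fun measurableSet_Ioo inner,
    lintegral_const_mul' _ _ ENNReal.ofReal_ne_top,
    setLIntegral_Ioo_sub_right_rpow (by linarith) hst, ← ENNReal.ofReal_mul (by positivity),
    ← ENNReal.ofReal_mul (by have := sub_pos.2 hα1; positivity)]
  congr 1
  have := (sub_pos.2 hα1).ne'
  rw [neg_add_eq_sub]
  field_simp

lemma lintegral_lintegral_Ici_rpow {s t : ℝ} (hα : 0 < α) (hα1 : α < 1) (hst : s ≤ t) :
    ∫⁻ x in Ici t, ∫⁻ y in Ico s t, ENNReal.ofReal ((x - y) ^ (-(α + 1))) =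
      ENNReal.ofReal (1 / (α * (1 - α))) * ENNReal.ofReal ((t - s) ^ (1 - α)) := by
  have inner : ∀ y ∈ Ico s t, ∫⁻ x in Ici t, ENNReal.ofReal ((x - y) ^ (-(α + 1))) =
      ENNReal.ofReal (1 / α) * ENNReal.ofReal ((t - y) ^ (-α)) := fun y hy => by
    rw [← restrict_Ioi_eq_restrict_Ici, setLIntegral_Ioi_sub_right_rpow (by linarith) hy.2,
      ← ENNReal.ofReal_mul (by positivity)]
    congr 1; ring_nf
  rw [lintegral_lintegral_swap (by fun_prop), setLIntegral_congr_fun measurableSet_Ico inner,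
    lintegral_const_mul' _ _ ENNReal.ofReal_ne_top, ← restrict_Ioo_eq_restrict_Ico,
    setLIntegral_Ioo_sub_left_rpow (by linarith) hst, ← ENNReal.ofReal_mul (by positivity),
    ← ENNReal.ofReal_mul (by have := sub_pos.2 hα1; positivity)]
  congr 1
  have := (sub_pos.2 hα1).ne'
  rw [neg_add_eq_sub]
  field_simp

lemma measurable_setLIntegral_Ioo {F : ℝ × ℝ → ℝ≥0∞} (hF : Measurable F) (a : ℝ) :
    Measurable fun x => ∫⁻ y in Ioo a x, F (x, y) := by
  have hS : MeasurableSet {p : ℝ × ℝ | p.2 ∈ Ioo a p.1} :=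
    (measurableSet_lt measurable_const measurable_snd).inter
      (measurableSet_lt measurable_snd measurable_fst)
  simp_rw [← lintegral_indicator measurableSet_Ioo]
  exact (hF.indicator hS).lintegral_prod_right' (ν := volume)

lemma measurable_leftIncrement {E : Type*} [NormedAddCommGroup E] [MeasurableSpace E]
    [BorelSpace E] [SecondCountableTopology E] {f : ℝ → E} (hf : Measurable f) (a : ℝ) :
    Measurable (leftIncrement α a f) :=
  measurable_setLIntegral_Ioo
    (F := fun p => ‖f p.1 - f p.2‖ₑ / ENNReal.ofReal ((p.1 - p.2) ^ (α + 1))) (by fun_prop) a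

lemma lintegral_leftIncrement_indicator_one_le {a s t : ℝ} (hα : 0 < α) (hα1 : α < 1)
    (hst : s ≤ t) :
    ∫⁻ x, leftIncrement α a ((Ico s t).indicator (1 : ℝ → ℝ)) x ≤
      2 * ENNReal.ofReal (1 / (α * (1 - α))) * ENNReal.ofReal ((t - s) ^ (1 - α)) := by
  refine (lintegral_mono fun x => leftIncrement_indicator_one_le).trans_eq ?_
  rw [lintegral_add_left, lintegral_indicator measurableSet_Ico,
    lintegral_indicator measurableSet_Ici, lintegral_lintegral_Iio_rpow hα hα1 hst,
    lintegral_lintegral_Ici_rpow hα hα1 hst, ← two_mul, mul_assoc]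
  exact Measurable.indicator (by fun_prop) measurableSet_Ico

lemma lintegral_enorm_indicator_div_rpow_le {E : Type*} [NormedAddCommGroup E] {f : ℝ → E}
    {K : ℝ≥0} (hα : 0 ≤ α) (hα1 : α < 1) {s t : ℝ}
    (hs : 0 ≤ s) (hst : s ≤ t) (hK : ∀ x ∈ Ico s t, ‖f x‖ₑ ≤ K) :
    ∫⁻ x, ‖(Ico s t).indicator f x‖ₑ / ENNReal.ofReal (x ^ α) ≤
      K * ENNReal.ofReal (1 / (1 - α)) * ENNReal.ofReal ((t - s) ^ (1 - α)) := by
  have := sub_pos.2 hα1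
  have hind : ∀ x, ‖(Ico s t).indicator f x‖ₑ / ENNReal.ofReal (x ^ α) =
      (Ico s t).indicator (fun x => ‖f x‖ₑ / ENNReal.ofReal (x ^ α)) x := fun x => by
    by_cases hx : x ∈ Ico s t <;> simp [hx]
  simp_rw [hind]
  rw [lintegral_indicator measurableSet_Ico, ← restrict_Ioo_eq_restrict_Ico]
  calc ∫⁻ x in Ioo s t, ‖f x‖ₑ / ENNReal.ofReal (x ^ α)
      ≤ ∫⁻ x in Ioo s t, K * ENNReal.ofReal ((x - s) ^ (-α)) := by
        refine setLIntegral_mono' measurableSet_Ioo fun x hx => ?_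
        have hxs := sub_pos.2 hx.1
        rw [← div_ofReal_rpow _ hxs]
        gcongr
        · exact hK x ⟨hx.1.le, hx.2⟩
        · linarith
    _ = _ := by
        rw [lintegral_const_mul' _ _ ENNReal.coe_ne_top,
          setLIntegral_Ioo_sub_right_rpow (by linarith) hst, mul_assoc,
          ← ENNReal.ofReal_mul (by positivity), neg_add_eq_sub]
        congr 2; ring

lemma lintegral_leftIncrement_indicator_le {E : Type*} [NormedAddCommGroup E] {f : ℝ → E}
    {K B : ℝ≥0} {a b s t : ℝ} (hα : 0 < α) (hα1 : α < 1) (hst : s ≤ t)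
    (hK : ∀ x ∈ Ioo a b, ‖f x‖ₑ ≤ K) (hB : ∀ x ∈ Ioo a b, leftIncrement α a f x ≤ B) :
    ∫⁻ x in Ioo a b, leftIncrement α a ((Ico s t).indicator f) x ≤ B * ENNReal.ofReal (t - s) +
      K * (2 * ENNReal.ofReal (1 / (α * (1 - α))) * ENNReal.ofReal ((t - s) ^ (1 - α))) := by
  calc _ ≤ ∫⁻ x in Ioo a b, ((Ico s t).indicator (fun _ => (B : ℝ≥0∞)) x +
        K * leftIncrement α a ((Ico s t).indicator (1 : ℝ → ℝ)) x) := by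
        refine setLIntegral_mono' measurableSet_Ioo fun x hx => ?_
        refine (leftIncrement_indicator_le measurableSet_Ico fun y hy =>
          hK y ⟨hy.1, hy.2.trans hx.2⟩).trans ?_
        gcongr
        exact hB x hx
    _ ≤ B * ENNReal.ofReal (t - s) +
        K * ∫⁻ x, leftIncrement α a ((Ico s t).indicator (1 : ℝ → ℝ)) x := by
        refine (setLIntegral_le_lintegral (Ioo a b) _).trans_eq ?_
        rw [lintegral_add_left (measurable_const.indicator measurableSet_Ico),
          lintegral_indicator_const measurableSet_Ico, Real.volume_Ico,
          lintegral_const_mul' _ _ ENNReal.coe_ne_top]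
    _ ≤ _ := by
        gcongr
        exact lintegral_leftIncrement_indicator_one_le hα hα1 hst

lemma ofReal_le_rpow_mul_rpow {u v : ℝ} (hα : 0 ≤ α) (hu : 0 ≤ u) (huv : u ≤ v) :
    ENNReal.ofReal u ≤ ENNReal.ofReal (v ^ α) * ENNReal.ofReal (u ^ (1 - α)) := by
  rw [← ENNReal.ofReal_mul (Real.rpow_nonneg (hu.trans huv) _)]
  refine ENNReal.ofReal_le_ofReal ?_
  calc u = u ^ α * u ^ (1 - α) := by
        rw [← Real.rpow_add' hu (by simp), add_sub_cancel, Real.rpow_one]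
    _ ≤ _ := by gcongr

lemma exists_eNormW1_indicator_le {γ T : ℝ} {f : ℝ → ℝ} (hα : 0 < α) (hα1 : α < 1)
    (hγ : α < γ) (hf : HolderOn γ f (Icc 0 T)) :
    ∃ C : ℝ≥0, ∀ s t, 0 ≤ s → s ≤ t → t ≤ T →
      eNormW1 α T ((Ico s t).indicator f) ≤ C * ENNReal.ofReal ((t - s) ^ (1 - α)) := by
  obtain ⟨K, hK⟩ := exists_enorm_le_of_continuousOn isCompact_Icc
    (hf.continuousOn (hα.trans hγ))
  obtain ⟨B, hB⟩ := hf.exists_leftIncrement_le hα.le hγ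
  refine ⟨K * (1 / (1 - α)).toNNReal +
    (B * (T ^ α).toNNReal + K * (2 * (1 / (α * (1 - α))).toNNReal)),
    fun s t hs hst ht => ?_⟩
  have hvalue := (setLIntegral_le_lintegral (Ioo 0 T) _).trans
    (lintegral_enorm_indicator_div_rpow_le hα.le hα1 hs hst fun x hx =>
      hK x ⟨hs.trans hx.1, hx.2.le.trans ht⟩)
  have hincrement := lintegral_leftIncrement_indicator_le (a := 0) (b := T) hα hα1 hst
    (fun x hx => hK x (Ioo_subset_Icc_self hx)) (fun x hx => hB x (Ioo_subset_Icc_self hx))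
  calc eNormW1 α T ((Ico s t).indicator f)
      ≤ K * ENNReal.ofReal (1 / (1 - α)) * ENNReal.ofReal ((t - s) ^ (1 - α)) +
        (B * (ENNReal.ofReal (T ^ α) * ENNReal.ofReal ((t - s) ^ (1 - α))) +
          K * (2 * ENNReal.ofReal (1 / (α * (1 - α))) *
            ENNReal.ofReal ((t - s) ^ (1 - α)))) := by
        refine add_le_add hvalue (hincrement.trans ?_)
        gcongr
        exact ofReal_le_rpow_mul_rpow hα.le (sub_nonneg.2 hst) (by linarith)
    _ = _ := by push_cast [ENNReal.ofReal]; ring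

end Truncation

/-! ### The generalized Stieltjes integral -/

section Stieltjes

lemma exists_measurable_eqOn {X Y : Type*} [MeasurableSpace X] [MeasurableSpace Y] [Nonempty Y]
    {S : Set X} (hS : MeasurableSet S) {f : X → Y} (hf : Measurable fun x : S => f x) :
    ∃ f' : X → Y, Measurable f' ∧ EqOn f f' S := by
  obtain ⟨f', hf', h⟩ := (MeasurableEmbedding.subtype_coe hS).exists_measurable_extend hf
    fun _ => inferInstance
  exact ⟨f', hf', fun x hx => (congrFun h ⟨x, hx⟩).symm⟩

lemma intervalIntegral_eq_Ioo {a b : ℝ} (h : a ≤ b) (f : ℝ → ℝ) :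
    ∫ x in a..b, f x = ∫ x in Ioo a b, f x := by
  rw [intervalIntegral.integral_of_le h, integral_Ioc_eq_integral_Ioo]

lemma enorm_intervalIntegral_le {a b : ℝ} (h : a ≤ b) (f : ℝ → ℝ) :
    ‖∫ x in a..b, f x‖ₑ ≤ ∫⁻ x in Ioo a b, ‖f x‖ₑ := by
  rw [intervalIntegral_eq_Ioo h]
  exact enorm_integral_le_lintegral_enorm _

lemma measurable_intervalIntegral {F : ℝ × ℝ → ℝ} (hF : Measurable F) {u v : ℝ → ℝ}
    (hu : Measurable u) (hv : Measurable v) : Measurable fun x => ∫ y in u x..v x, F (x, y) := by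
  have key : ∀ {u v : ℝ → ℝ}, Measurable u → Measurable v →
      Measurable fun x => ∫ y in Ioc (u x) (v x), F (x, y) := fun {u v} hu hv => by
    have hS : MeasurableSet {p : ℝ × ℝ | p.2 ∈ Ioc (u p.1) (v p.1)} :=
      (measurableSet_lt (hu.comp measurable_fst) measurable_snd).inter
        (measurableSet_le measurable_snd (hv.comp measurable_fst))
    simp_rw [← integral_indicator measurableSet_Ioc]
    exact ((hF.indicator hS).stronglyMeasurable.integral_prod_right' (ν := volume)).measurable
  exact (key hu hv).sub (key hv hu)

lemma enorm_div_rpow (x : ℝ) {u : ℝ} (hu : 0 < u) (q : ℝ) :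
    ‖x / u ^ q‖ₑ = ‖x‖ₑ / ENNReal.ofReal (u ^ q) := by
  have h := Real.rpow_pos_of_pos hu q
  rw [← ofReal_norm, ← ofReal_norm, norm_div, Real.norm_of_nonneg h.le,
    ENNReal.ofReal_div_of_pos h]

lemma enorm_mul_add_mul_le {γ c : ℝ} (hγ : γ ∈ Icc 0 1) (hc : 0 ≤ c) (x y : ℝ) :
    ‖c * (x + γ * y)‖ₑ ≤ ENNReal.ofReal c * (‖x‖ₑ + ‖y‖ₑ) := by
  rw [enorm_mul, Real.enorm_of_nonneg hc]
  gcongr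
  refine (enorm_add_le _ _).trans (add_le_add_right ?_ _)
  rw [enorm_mul, Real.enorm_of_nonneg hγ.1]
  exact mul_le_of_le_one_left' (ENNReal.ofReal_le_one.2 hγ.2)

variable {α γ T : ℝ} {f f' g g' : ℝ → ℝ}

lemma measurable_weylLeft (hf : Measurable f) : Measurable (weylLeft α f) :=
  measurable_const.mul ((by fun_prop : Measurable fun x => f x / x ^ α).add
    (measurable_const.mul (measurable_intervalIntegral
      (F := fun p => (f p.1 - f p.2) / (p.1 - p.2) ^ (α + 1)) (by fun_prop)
      measurable_const measurable_id)))

lemma measurable_weylRight (hg : Measurable g) : Measurable (weylRight γ T g) :=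
  measurable_const.mul ((by fun_prop : Measurable fun x => g x / (T - x) ^ γ).add
    (measurable_const.mul (measurable_intervalIntegral
      (F := fun p => (g p.1 - g p.2) / (p.2 - p.1) ^ (γ + 1)) (by fun_prop)
      measurable_id measurable_const)))

lemma weylLeft_congr (h : EqOn f f' (Ioo 0 T)) :
    EqOn (weylLeft α f) (weylLeft α f') (Ioo 0 T) := fun x hx => by
  rw [weylLeft, weylLeft, intervalIntegral_eq_Ioo hx.1.le, intervalIntegral_eq_Ioo hx.1.le, h hx]
  congr 3
  exact setIntegral_congr_fun measurableSet_Ioo fun y hy => by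
    simp only [h ⟨hy.1, hy.2.trans hx.2⟩]

lemma weylRight_congr (h : EqOn g g' (Ioo 0 T)) :
    EqOn (weylRight γ T g) (weylRight γ T g') (Ioo 0 T) := fun x hx => by
  rw [weylRight, weylRight, intervalIntegral_eq_Ioo hx.2.le, intervalIntegral_eq_Ioo hx.2.le,
    h hx]
  congr 3
  exact setIntegral_congr_fun measurableSet_Ioo fun y hy => by
    simp only [h ⟨hx.1.trans hy.1, hy.2⟩]

lemma leftIncrement_congr {E : Type*} [NormedAddCommGroup E] {f f' : ℝ → E} {a b : ℝ}
    (h : EqOn f f' (Ioo a b)) : EqOn (leftIncrement α a f) (leftIncrement α a f') (Ioo a b) :=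
  fun x hx => setLIntegral_congr_fun measurableSet_Ioo fun y hy => by
    simp only [h hx, h ⟨hy.1, hy.2.trans hx.2⟩]

lemma eNormW1_congr (h : EqOn f f' (Ioo 0 T)) : eNormW1 α T f = eNormW1 α T f' :=
  congrArg₂ (· + ·)
    (setLIntegral_congr_fun measurableSet_Ioo fun x hx => by simp only [h hx])
    (setLIntegral_congr_fun measurableSet_Ioo (leftIncrement_congr h))

lemma enorm_weylLeft_le (hα : α ∈ Ico 0 1) (f : ℝ → ℝ) {x : ℝ} (hx : 0 < x) :
    ‖weylLeft α f x‖ₑ ≤ ENNReal.ofReal (1 / Real.Gamma (1 - α)) *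
      (‖f x‖ₑ / ENNReal.ofReal (x ^ α) + leftIncrement α 0 f x) := by
  have hΓ := Real.Gamma_pos_of_pos (sub_pos.2 hα.2)
  refine (enorm_mul_add_mul_le (Ico_subset_Icc_self hα) (by positivity) _ _).trans ?_
  rw [enorm_div_rpow _ hx]
  gcongr
  refine (enorm_intervalIntegral_le hx.le _).trans_eq ?_
  exact setLIntegral_congr_fun measurableSet_Ioo fun y hy => enorm_div_rpow _ (sub_pos.2 hy.2) _

lemma enorm_weylRight_le (hγ : γ ∈ Ico 0 1) (g : ℝ → ℝ) {x : ℝ} (hx : x < T) :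
    ‖weylRight γ T g x‖ₑ ≤ ENNReal.ofReal (1 / Real.Gamma (1 - γ)) *
      (‖g x‖ₑ / ENNReal.ofReal ((T - x) ^ γ) +
        ∫⁻ y in Ioo x T, ‖g x - g y‖ₑ / ENNReal.ofReal ((y - x) ^ (γ + 1))) := by
  have hΓ := Real.Gamma_pos_of_pos (sub_pos.2 hγ.2)
  refine (enorm_mul_add_mul_le (Ico_subset_Icc_self hγ) (by positivity) _ _).trans ?_
  rw [enorm_div_rpow _ (sub_pos.2 hx)]
  gcongr
  refine (enorm_intervalIntegral_le hx.le _).trans_eq ?_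
  exact setLIntegral_congr_fun measurableSet_Ioo fun y hy => enorm_div_rpow _ (sub_pos.2 hy.1) _

lemma MemW1.exists_measurable_eqOn (hf : MemW1 α T f) :
    ∃ f' : ℝ → ℝ, Measurable f' ∧ EqOn f f' (Ioo 0 T) := by
  obtain ⟨f', hf', h⟩ := DelayEq.exists_measurable_eqOn measurableSet_Icc hf.1
  exact ⟨f', hf', h.mono Ioo_subset_Icc_self⟩

lemma MemW1.aemeasurable_leftIncrement (hf : MemW1 α T f) :
    AEMeasurable (leftIncrement α 0 f) (volume.restrict (Ioo 0 T)) := by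
  obtain ⟨f', hf', h⟩ := hf.exists_measurable_eqOn
  exact ⟨_, measurable_leftIncrement hf' 0,
    ae_restrict_of_forall_mem measurableSet_Ioo (leftIncrement_congr h)⟩

lemma MemW1.lintegral_enorm_weylLeft_le (hα : α ∈ Ico 0 1) (hf : MemW1 α T f) :
    ∫⁻ x in Ioo 0 T, ‖weylLeft α f x‖ₑ ≤
      ENNReal.ofReal (1 / Real.Gamma (1 - α)) * eNormW1 α T f := by
  refine (setLIntegral_mono' measurableSet_Ioo fun x hx => enorm_weylLeft_le hα f hx.1).trans ?_
  rw [lintegral_const_mul' _ _ ENNReal.ofReal_ne_top,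
    lintegral_add_right' _ hf.aemeasurable_leftIncrement]
  rfl

lemma MemW1.integrableOn_weylLeft (hα : α ∈ Ico 0 1) (hf : MemW1 α T f) :
    IntegrableOn (weylLeft α f) (Ioo 0 T) := by
  obtain ⟨f', hf', h⟩ := hf.exists_measurable_eqOn
  exact ⟨⟨_, (measurable_weylLeft hf').stronglyMeasurable,
      ae_restrict_of_forall_mem measurableSet_Ioo (weylLeft_congr h)⟩,
    (hf.lintegral_enorm_weylLeft_le hα).trans_lt (ENNReal.mul_lt_top ENNReal.ofReal_lt_top hf.2)⟩

lemma MemW1.ae_intervalIntegrable_increment (hf : MemW1 α T f) :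
    ∀ᵐ x ∂volume.restrict (Ioo 0 T),
      IntervalIntegrable (fun y => (f x - f y) / (x - y) ^ (α + 1)) volume 0 x := by
  have hfin : ∫⁻ x in Ioo 0 T, leftIncrement α 0 f x ≠ ∞ :=
    ne_top_of_le_ne_top hf.2.ne le_add_self
  obtain ⟨f', hf', h⟩ := hf.exists_measurable_eqOn
  filter_upwards [ae_lt_top' hf.aemeasurable_leftIncrement hfin,
    ae_restrict_mem measurableSet_Ioo] with x hx hxT
  rw [intervalIntegrable_iff_integrableOn_Ioo_of_le hxT.1.le]
  refine ⟨⟨fun y => (f x - f' y) / (x - y) ^ (α + 1), by fun_prop,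
    ae_restrict_of_forall_mem measurableSet_Ioo fun y hy => ?_⟩, lt_of_eq_of_lt ?_ hx⟩
  · simp only [h ⟨hy.1, hy.2.trans hxT.2⟩]
  · exact setLIntegral_congr_fun measurableSet_Ioo fun y hy => enorm_div_rpow _ (sub_pos.2 hy.2) _

lemma MemW1.weylLeft_add (hf : MemW1 α T f) (hf' : MemW1 α T f') :
    ∀ᵐ x ∂volume.restrict (Ioo 0 T),
      weylLeft α (f + f') x = weylLeft α f x + weylLeft α f' x := by
  filter_upwards [hf.ae_intervalIntegrable_increment,
    hf'.ae_intervalIntegrable_increment] with x h h'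
  have hsplit : ∀ y, ((f + f') x - (f + f') y) / (x - y) ^ (α + 1) =
      (f x - f y) / (x - y) ^ (α + 1) + (f' x - f' y) / (x - y) ^ (α + 1) := fun y => by
    simp only [Pi.add_apply]; ring
  simp_rw [weylLeft, hsplit]
  rw [intervalIntegral.integral_add h h', Pi.add_apply]
  ring

section MemWT

variable {E : Type*} [NormedAddCommGroup E] {g : ℝ → E}

lemma enorm_sub_le_eNormWT {s t : ℝ} (hs : 0 < s) (hst : s < t) (ht : t < T) :
    ‖g t - g s‖ₑ ≤ eNormWT α T g * ENNReal.ofReal ((t - s) ^ (1 - α)) := by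
  have hpos := Real.rpow_pos_of_pos (sub_pos.2 hst) (1 - α)
  rw [← ENNReal.div_le_iff (ENNReal.ofReal_pos.2 hpos).ne' ENNReal.ofReal_ne_top]
  exact le_self_add.trans
    (le_iSup₂_of_le s ⟨hs, hst.trans ht⟩ (le_iSup₂_of_le t ⟨hst, ht⟩ le_rfl))

lemma lintegral_right_increment_le {s : ℝ} (hs : s ∈ Ioo 0 T) :
    ∫⁻ u in Ioo s T, ‖g u - g s‖ₑ / ENNReal.ofReal ((u - s) ^ (2 - α)) ≤ eNormWT α T g := by
  obtain ⟨v, hv, hvT, hlim⟩ := exists_seq_strictMono_tendsto' hs.2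
  have hcover : ⋃ n, Ioo s (v n) = Ioo s T := by
    refine Subset.antisymm (iUnion_subset fun n => Ioo_subset_Ioo_right (hvT n).2.le)
      fun u hu => ?_
    obtain ⟨n, hn⟩ := (hlim.eventually (lt_mem_nhds hu.2)).exists
    exact mem_iUnion.2 ⟨n, hu.1, hn⟩
  rw [← hcover, setLIntegral_iUnion_of_directed _
    (Monotone.directed_le fun m n hmn => Ioo_subset_Ioo_right (hv.monotone hmn))]
  exact iSup_le fun n => le_add_self.trans
    (le_iSup₂_of_le s hs (le_iSup₂_of_le (v n) (hvT n) le_rfl))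

variable [MeasurableSpace E]

lemma MemWT.holderOn (hα1 : α ≤ 1) (hg : MemWT α T g) : HolderOn (1 - α) g (Ioo 0 T) := by
  refine (holderOn_iff (sub_nonneg.2 hα1)).2 ⟨(eNormWT α T g).toNNReal, fun s hs t ht hst => ?_⟩
  rw [ENNReal.coe_toNNReal hg.2.ne]
  exact enorm_sub_le_eNormWT hs.1 hst ht.2

lemma MemWT.tendsto_leftLim [CompleteSpace E] (hα1 : α < 1) (hT : 0 < T) (hg : MemWT α T g) :
    Tendsto g (𝓝[<] T) (𝓝 (Function.leftLim g T)) := by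
  refine tendsto_leftLim_of_tendsto (cauchy_map_iff_exists_tendsto.1 ?_)
  exact Cauchy.map_of_le (cauchy_nhds.mono nhdsWithin_le_nhds)
    ((hg.holderOn hα1.le).uniformContinuousOn (sub_pos.2 hα1))
    (le_principal_iff.2 (Ioo_mem_nhdsLT hT))

lemma MemWT.enorm_sub_leftLim_le [CompleteSpace E] (hα1 : α < 1) (hg : MemWT α T g) {s : ℝ}
    (hs : s ∈ Ioo 0 T) :
    ‖g s - Function.leftLim g T‖ₑ ≤ eNormWT α T g * ENNReal.ofReal ((T - s) ^ (1 - α)) := by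
  have hlim := ((hg.tendsto_leftLim hα1 (hs.1.trans hs.2)).sub_const (g s)).enorm
  rw [← enorm_sub_rev]
  refine le_of_tendsto hlim ?_
  filter_upwards [Ioo_mem_nhdsLT hs.2] with t ht
  refine (enorm_sub_le_eNormWT (α := α) hs.1 ht.1 ht.2).trans ?_
  have := sub_pos.2 ht.1
  have := sub_pos.2 hα1
  gcongr
  exact ht.2.le

end MemWT

lemma MemWT.aestronglyMeasurable_weylRight (hg : MemWT α T g) (γ c : ℝ) :
    AEStronglyMeasurable (weylRight γ T fun u => g u - c) (volume.restrict (Ioo 0 T)) := by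
  obtain ⟨g', hg', h⟩ := exists_measurable_eqOn measurableSet_Icc hg.1
  refine ⟨_, (measurable_weylRight (hg'.sub_const c)).stronglyMeasurable,
    ae_restrict_of_forall_mem measurableSet_Ioo (weylRight_congr fun u hu => ?_)⟩
  rw [h (Ioo_subset_Icc_self hu)]

lemma MemWT.enorm_weylRight_le (hα : α ∈ Ioo 0 1) (hg : MemWT α T g) {x : ℝ}
    (hx : x ∈ Ioo 0 T) : ‖weylRight (1 - α) T (fun u => g u - Function.leftLim g T) x‖ₑ ≤
      ENNReal.ofReal (1 / Real.Gamma α) * (2 * eNormWT α T g) := by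
  have hpos := Real.rpow_pos_of_pos (sub_pos.2 hx.2) (1 - α)
  refine (DelayEq.enorm_weylRight_le ⟨by linarith [hα.2], by linarith [hα.1]⟩ _ hx.2).trans ?_
  rw [sub_sub_cancel, two_mul]
  gcongr
  · rw [ENNReal.div_le_iff (ENNReal.ofReal_pos.2 hpos).ne' ENNReal.ofReal_ne_top]
    exact hg.enorm_sub_leftLim_le hα.2 hx
  · refine le_trans (le_of_eq ?_) (lintegral_right_increment_le hx)
    refine setLIntegral_congr_fun measurableSet_Ioo fun y _ => ?_
    rw [sub_sub_sub_cancel_right, enorm_sub_rev, sub_add_eq_add_sub, one_add_one_eq_two]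

lemma stieltjes_congr (hT : 0 ≤ T) (h : EqOn f f' (Ioo 0 T)) (g : ℝ → ℝ) :
    stieltjes α T f g = stieltjes α T f' g := by
  rw [stieltjes, stieltjes, intervalIntegral_eq_Ioo hT, intervalIntegral_eq_Ioo hT,
    setIntegral_congr_fun measurableSet_Ioo fun x hx => by rw [weylLeft_congr h hx]]

lemma MemW1.integrableOn_weylLeft_mul_weylRight (hα : α ∈ Ioo 0 1) (hf : MemW1 α T f)
    (hg : MemWT α T g) : IntegrableOn (fun s =>
      weylLeft α f s * weylRight (1 - α) T (fun u => g u - Function.leftLim g T) s)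
      (Ioo 0 T) := by
  refine (hf.integrableOn_weylLeft (Ioo_subset_Ico_self hα)).mul_bdd
    (c := (ENNReal.ofReal (1 / Real.Gamma α) * (2 * eNormWT α T g)).toReal)
    (hg.aestronglyMeasurable_weylRight _ _) ?_
  refine ae_restrict_of_forall_mem measurableSet_Ioo fun x hx => ?_
  rw [← toReal_enorm]
  have := hg.2.ne
  exact ENNReal.toReal_mono (by finiteness) (hg.enorm_weylRight_le hα hx)

lemma stieltjes_add (hα : α ∈ Ioo 0 1) (hT : 0 ≤ T) (hg : MemWT α T g)
    (hf : MemW1 α T f) (hf' : MemW1 α T f') :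
    stieltjes α T (f + f') g = stieltjes α T f g + stieltjes α T f' g := by
  simp only [stieltjes, intervalIntegral_eq_Ioo hT]
  rw [← neg_add, ← integral_add (hf.integrableOn_weylLeft_mul_weylRight hα hg)
    (hf'.integrableOn_weylLeft_mul_weylRight hα hg)]
  refine congrArg Neg.neg (integral_congr_ae ?_)
  filter_upwards [hf.weylLeft_add hf'] with x hx
  rw [hx, add_mul]

lemma exists_enorm_stieltjes_le (hα : α ∈ Ioo 0 1) (hT : 0 ≤ T) (hg : MemWT α T g) :
    ∃ C : ℝ≥0, ∀ f : ℝ → ℝ, MemW1 α T f → ‖stieltjes α T f g‖ₑ ≤ C * eNormW1 α T f := by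
  set R := ENNReal.ofReal (1 / Real.Gamma α) * (2 * eNormWT α T g)
  have hR : R ≠ ∞ := by have := hg.2.ne; finiteness
  refine ⟨(R * ENNReal.ofReal (1 / Real.Gamma (1 - α))).toNNReal, fun f hf => ?_⟩
  rw [ENNReal.coe_toNNReal (by finiteness), stieltjes, enorm_neg, mul_assoc]
  calc _ ≤ ∫⁻ s in Ioo 0 T, R * ‖weylLeft α f s‖ₑ := by
        refine (enorm_intervalIntegral_le hT _).trans
          (setLIntegral_mono' measurableSet_Ioo fun s hs => ?_)
        rw [enorm_mul, mul_comm]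
        gcongr
        exact hg.enorm_weylRight_le hα hs
    _ ≤ _ := by
        rw [lintegral_const_mul' _ _ hR]
        gcongr
        exact hf.lintegral_enorm_weylLeft_le (Ioo_subset_Ico_self hα)

lemma indicator_Ioo_eqOn_indicator_Ico (f : ℝ → ℝ) (t : ℝ) :
    EqOn ((Ioo 0 t).indicator f) ((Ico 0 t).indicator f) (Ioo 0 T) := fun x hx => by
  simp only [indicator, mem_Ioo, mem_Ico, hx.1, hx.1.le]

lemma HolderOn.memW1_indicator_Ico (hα : α ∈ Ioo 0 1) (hγ : α < γ)
    (hf : HolderOn γ f (Icc 0 T)) {s t : ℝ} (hs : 0 ≤ s) (hst : s ≤ t) (ht : t ≤ T) :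
    MemW1 α T ((Ico s t).indicator f) := by
  obtain ⟨C, hC⟩ := exists_eNormW1_indicator_le hα.1 hα.2 hγ hf
  have hcont := continuousOn_iff_continuous_domRestrict.1 (hf.continuousOn (hα.1.trans hγ))
  exact ⟨hcont.measurable.indicator (measurable_subtype_coe measurableSet_Ico),
    (hC s t hs hst ht).trans_lt (by finiteness)⟩

lemma HolderOn.memW1_indicator_Ioo (hα : α ∈ Ioo 0 1) (hγ : α < γ)
    (hf : HolderOn γ f (Icc 0 T)) {t : ℝ} (ht : t ∈ Icc 0 T) :
    MemW1 α T ((Ioo 0 t).indicator f) := by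
  have hcont := continuousOn_iff_continuous_domRestrict.1 (hf.continuousOn (hα.1.trans hγ))
  refine ⟨hcont.measurable.indicator (measurable_subtype_coe measurableSet_Ioo), ?_⟩
  rw [eNormW1_congr (indicator_Ioo_eqOn_indicator_Ico f t)]
  exact (hf.memW1_indicator_Ico hα hγ le_rfl ht.1 ht.2).2

lemma stieltjesTo_eq_add (hα : α ∈ Ioo 0 1) (hγ : α < γ) (hg : MemWT α T g)
    (hf : HolderOn γ f (Icc 0 T)) {s t : ℝ} (hs : 0 ≤ s) (hst : s ≤ t) (ht : t ≤ T) :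
    stieltjesTo α T f g t = stieltjesTo α T f g s + stieltjes α T ((Ico s t).indicator f) g := by
  have hT : 0 ≤ T := hs.trans (hst.trans ht)
  rw [stieltjesTo, stieltjesTo, stieltjes_congr hT (indicator_Ioo_eqOn_indicator_Ico f t),
    stieltjes_congr hT (indicator_Ioo_eqOn_indicator_Ico f s),
    ← stieltjes_add hα hT hg (hf.memW1_indicator_Ico hα hγ le_rfl hs (hst.trans ht))
      (hf.memW1_indicator_Ico hα hγ hs hst ht),
    ← Ico_union_Ico_eq_Ico hs hst, indicator_union_of_disjoint Ico_disjoint_Ico_same f]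
  rfl

lemma HolderOn.stieltjesTo (hα : α ∈ Ioo 0 1) (hγ : α < γ) (hT : 0 ≤ T) (hg : MemWT α T g)
    (hf : HolderOn γ f (Icc 0 T)) :
    HolderOn (1 - α) (stieltjesTo α T f g) (Icc 0 T) := by
  obtain ⟨C, hC⟩ := exists_eNormW1_indicator_le hα.1 hα.2 hγ hf
  obtain ⟨D, hD⟩ := exists_enorm_stieltjes_le hα hT hg
  refine (holderOn_iff (sub_nonneg.2 hα.2.le)).2 ⟨D * C, fun s hs t ht hst => ?_⟩
  rw [stieltjesTo_eq_add hα hγ hg hf hs.1 hst.le ht.2, add_sub_cancel_left, ENNReal.coe_mul,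
    mul_assoc]
  exact (hD _ (hf.memW1_indicator_Ico hα hγ hs.1 hst.le ht.2)).trans
    (by gcongr; exact hC s t hs.1 hst.le ht.2)

lemma stieltjesTo_zero (f g : ℝ → ℝ) : stieltjesTo α T f g 0 = 0 := by
  simp [stieltjesTo, stieltjes, weylLeft]

lemma stieltjesTo_congr {t : ℝ} (h : EqOn f f' (Ioo 0 t)) (g : ℝ → ℝ) :
    stieltjesTo α T f g t = stieltjesTo α T f' g t := by
  rw [stieltjesTo, stieltjesTo, indicator_congr h]

end Stieltjes

/-! ### Vector-valued integrals -/

section Vector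

variable {X : Type*} [PseudoMetricSpace X] {α γ μ T : ℝ} {S : Set X}

lemma HolderOn.sum {E ι : Type*} [NormedAddCommGroup E] {f : ι → X → E} {s : Finset ι}
    (hf : ∀ i ∈ s, HolderOn μ (f i) S) : HolderOn μ (fun x => ∑ i ∈ s, f i x) S := by
  simp_rw [← Finset.sum_apply]
  exact Finset.sum_induction f (HolderOn μ · S) (fun _ _ => HolderOn.add)
    ⟨0, fun x _ y _ => by simp⟩ hf

lemma HolderOn.toLp {ι : Type*} [Fintype ι] {f : ι → X → ℝ} (hf : ∀ i, HolderOn μ (f i) S) :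
    HolderOn μ (fun x => WithLp.toLp 2 fun i => f i x) S := by
  choose C hC using hf
  have hpi : HolderOn μ (fun x i => f i x) S :=
    ⟨∑ i, C i, fun x hx y hy => edist_pi_le_iff.2 fun i => (hC i x hx y hy).trans <| by
      gcongr; exact Finset.single_le_sum (fun _ _ => zero_le) (Finset.mem_univ i)⟩
  exact HolderOn.lipschitz_comp
    ((PiLp.lipschitzWith_toLp 2 fun _ : ι => ℝ).lipschitzOnWith (s := univ)) hpi fun _ _ => trivial

lemma lipschitzWith_euclidean_apply {ι : Type*} [Fintype ι] (i : ι) :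
    LipschitzWith 1 fun v : EuclideanSpace ℝ ι => v i := by
  have h := (LipschitzWith.eval i).comp (PiLp.lipschitzWith_ofLp 2 fun _ : ι => ℝ)
  rwa [mul_one] at h

lemma MemWT.lipschitz_comp {E F : Type*} [NormedAddCommGroup E] [MeasurableSpace E]
    [OpensMeasurableSpace E] [NormedAddCommGroup F] [MeasurableSpace F] [BorelSpace F]
    {K : ℝ≥0} {φ : E → F} (hφ : LipschitzWith K φ) {g : ℝ → E} (hg : MemWT α T g) :
    MemWT α T (φ ∘ g) := by
  have hle : ∀ s t, ‖φ (g t) - φ (g s)‖ₑ ≤ K * ‖g t - g s‖ₑ := fun s t => by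
    simpa only [edist_eq_enorm_sub] using hφ (g t) (g s)
  refine ⟨hφ.continuous.measurable.comp hg.1, lt_of_le_of_lt (iSup₂_le fun s hs =>
    iSup₂_le fun t ht => ?_) (ENNReal.mul_lt_top (a := K) ENNReal.coe_lt_top hg.2)⟩
  refine le_trans ?_ (mul_le_mul_right
    (le_iSup₂_of_le s hs (le_iSup₂_of_le t ht le_rfl)) (K : ℝ≥0∞))
  rw [mul_add, ← lintegral_const_mul' _ _ ENNReal.coe_ne_top, ← mul_div_assoc]
  simp_rw [← mul_div_assoc]
  gcongr
  exacts [hle s t, hle s _]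

variable {ι κ : Type*} [Fintype κ]

/-- The indefinite integral `∫_0^t F dg` of a matrix-valued `F` against a vector-valued `g`. -/
def matrixStieltjesTo (α T : ℝ) (F : ℝ → EuclideanSpace ℝ (ι × κ)) (g : ℝ → EuclideanSpace ℝ κ)
    (t : ℝ) : EuclideanSpace ℝ ι :=
  WithLp.toLp 2 fun i => ∑ j, stieltjesTo α T (fun s => F s (i, j)) (fun s => g s j) t

variable {F F' : ℝ → EuclideanSpace ℝ (ι × κ)} {g : ℝ → EuclideanSpace ℝ κ}

lemma HolderOn.euclidean_apply [Fintype ι] (hF : HolderOn μ F (Icc 0 T)) (i : ι × κ) :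
    HolderOn μ (fun s => F s i) (Icc 0 T) :=
  HolderOn.lipschitz_comp (lipschitzWith_euclidean_apply i).lipschitzOnWith hF (mapsTo_univ _ _)

lemma HolderOn.matrixStieltjesTo [Fintype ι] (hα : α ∈ Ioo 0 1) (hγ : α < γ) (hT : 0 ≤ T)
    (hg : MemWT α T g) (hF : HolderOn γ F (Icc 0 T)) :
    HolderOn (1 - α) (matrixStieltjesTo α T F g) (Icc 0 T) :=
  .toLp fun i => .sum fun j _ => .stieltjesTo hα hγ hT
    (hg.lipschitz_comp (lipschitzWith_euclidean_apply j)) (hF.euclidean_apply (i, j))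

lemma matrixStieltjesTo_zero : matrixStieltjesTo α T F g 0 = 0 := by
  ext i
  simp [matrixStieltjesTo, stieltjesTo_zero]

lemma matrixStieltjesTo_congr {t : ℝ} (h : EqOn F F' (Ioo 0 t)) :
    matrixStieltjesTo α T F g t = matrixStieltjesTo α T F' g t := by
  ext i
  exact Finset.sum_congr rfl fun j _ => stieltjesTo_congr (fun s hs => by rw [h hs]) _

/-- The regularity of a diffusion coefficient `σ(t,x)` that survives composition with Hölder
paths: locally Lipschitz in `x`, and `β`-Hölder in `t` locally uniformly in `x`. -/
structure RegularCoefficient {E F : Type*} [NormedAddCommGroup E] [NormedAddCommGroup F]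
    (T β : ℝ) (σ : ℝ → E → F) : Prop where
  lipschitz : ∀ N : ℝ, ∃ K : ℝ≥0, ∀ t ∈ Icc 0 T,
    LipschitzOnWith K (σ t) (Metric.closedBall 0 N)
  holder : ∀ N : ℝ, ∃ C : ℝ≥0, ∀ x ∈ Metric.closedBall (0 : E) N,
    HolderOnWith C β.toNNReal (fun t => σ t x) (Icc 0 T)

lemma RegularCoefficient.holderOn_comp {E F : Type*} [NormedAddCommGroup E]
    [NormedAddCommGroup F] {β : ℝ} {σ : ℝ → E → F} (hσ : RegularCoefficient T β σ) (hμ : 0 < μ)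
    {y : ℝ → E} (hy : HolderOn μ y (Icc 0 T)) :
    HolderOn (min β μ) (fun t => σ t (y t)) (Icc 0 T) := by
  obtain ⟨N, hN⟩ := isCompact_Icc.exists_bound_of_continuousOn (hy.continuousOn hμ)
  replace hN : ∀ t ∈ Icc 0 T, y t ∈ Metric.closedBall 0 N := by simpa using hN
  obtain ⟨K, hK⟩ := hσ.lipschitz N
  obtain ⟨C, hC⟩ := hσ.holder N
  obtain ⟨A, hA⟩ := hy.of_le (Metric.isBounded_Icc 0 T) (min_le_right β μ)
  obtain ⟨D, hD⟩ := Metric.isBounded_iff.1 (Metric.isBounded_Icc (0 : ℝ) T)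
  obtain ⟨B, hB⟩ : ∃ B : ℝ≥0, ∀ x ∈ Metric.closedBall (0 : E) N,
      HolderOnWith B (min β μ).toNNReal (fun t => σ t x) (Icc 0 T) :=
    ⟨_, fun x hx => (hC x hx).of_le (D := D.toNNReal) (fun s hs t ht => by
      rw [edist_dist]; exact ENNReal.ofReal_le_ofReal (hD hs ht))
      (Real.toNNReal_le_toNNReal (min_le_left β μ))⟩
  refine ⟨K * A + B, fun t ht s hs => (edist_triangle _ (σ t (y s)) _).trans ?_⟩
  rw [ENNReal.coe_add, add_mul, ENNReal.coe_mul, mul_assoc]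
  exact add_le_add ((hK t ht (hN t ht) (hN s hs)).trans (by gcongr; exact hA t ht s hs))
    (hB _ (hN s hs) t ht s hs)

end Vector

/-! ### The forced equation -/

lemma holderOn_primitive_of_memLp {E : Type*} [NormedAddCommGroup E] [NormedSpace ℝ E]
    {f : ℝ → E} {p : ℝ≥0∞} (hp : 1 ≤ p) {a b c : ℝ} (hc : c ∈ Icc a b)
    (hf : MemLp f p (volume.restrict (Icc a b))) :
    HolderOn (1 - p.toReal⁻¹) (fun t => ∫ s in c..t, f s) (Icc a b) := by
  have hp' : 0 ≤ 1 - p.toReal⁻¹ := by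
    rw [sub_nonneg, ← ENNReal.toReal_inv, ← ENNReal.toReal_one]
    exact ENNReal.toReal_mono ENNReal.one_ne_top (ENNReal.inv_le_one.2 hp)
  have hint : ∀ u ∈ Icc a b, IntervalIntegrable f volume c u := fun u hu =>
    (IntegrableOn.mono_set (hf.integrable hp) (uIcc_subset_Icc hc hu)).intervalIntegrable
  refine (holderOn_iff hp').2 ⟨(eLpNorm f p (volume.restrict (Icc a b))).toNNReal,
    fun s hs t ht hst => ?_⟩
  have hsub : Ioc s t ⊆ Icc a b := Ioc_subset_Icc_self.trans (Icc_subset_Icc hs.1 ht.2)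
  rw [ENNReal.coe_toNNReal hf.2.ne,
    intervalIntegral.integral_interval_sub_left (hint t ht) (hint s hs),
    intervalIntegral.integral_of_le hst.le]
  calc ‖∫ u in Ioc s t, f u‖ₑ
      ≤ eLpNorm f 1 (volume.restrict (Ioc s t)) := by
        rw [eLpNorm_one_eq_lintegral_enorm]
        exact enorm_integral_le_lintegral_enorm f
    _ ≤ eLpNorm f p (volume.restrict (Ioc s t)) * ENNReal.ofReal ((t - s) ^ (1 - p.toReal⁻¹)) := by
        refine (eLpNorm_le_eLpNorm_mul_rpow_measure_univ hp
          (hf.1.mono_measure (Measure.restrict_mono hsub le_rfl))).trans_eq ?_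
        rw [Measure.restrict_apply_univ, Real.volume_Ioc, ENNReal.toReal_one, one_div_one,
          one_div, ENNReal.ofReal_rpow_of_nonneg (sub_nonneg.2 hst.le) hp']
    _ ≤ _ := by
        gcongr

lemma exists_isFixedPt_of_dist_iterate_le {X : Type*} [MetricSpace X] {s : Set X} {f : X → X}
    {c : ℕ → ℝ} (hs : IsComplete s) (hne : s.Nonempty) (hf : MapsTo f s s)
    (hc : Tendsto c atTop (𝓝 0))
    (h : ∀ n, ∀ x ∈ s, ∀ y ∈ s, dist (f^[n] x) (f^[n] y) ≤ c n * dist x y) :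
    ∃ x ∈ s, Function.IsFixedPt f x := by
  obtain ⟨n, hn⟩ := (hc.eventually_lt_const (by norm_num : (0 : ℝ) < (2⁻¹ : ℝ≥0))).exists
  have hcontr : ContractingWith 2⁻¹ (hf.restrict f s s)^[n] := by
    refine ⟨by norm_num, LipschitzWith.of_dist_le_mul fun x y => ?_⟩
    rw [hf.iterate_restrict]
    exact (h n x x.2 y y.2).trans (mul_le_mul_of_nonneg_right hn.le dist_nonneg)
  have : CompleteSpace s := hs.completeSpace_coe
  have : Nonempty s := hne.to_subtype
  exact ⟨_, Subtype.coe_prop _,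
    congrArg Subtype.val (ContractingWith.isFixedPt_fixedPoint_iterate hcontr)⟩

section Forced

variable {E : Type*} [NormedAddCommGroup E] {a T : ℝ}

lemma supUpTo_le {z : C(Icc a T, E)} {t C : ℝ} (hC : 0 ≤ C)
    (h : ∀ s : Icc a T, (s : ℝ) ≤ t → ‖z s‖ ≤ C) : supUpTo t z ≤ C :=
  Real.iSup_le (fun s => h s s.2) hC

/-- The regularity of a path-dependent drift that makes the equation with a prescribed continuous
forcing uniquely solvable. The bounds through `supUpTo t` contain its causality. -/
structure RegularDrift (p : ℝ≥0∞) (b : ℝ → C(Icc a T, E) → E) : Prop where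
  aestronglyMeasurable : ∀ x, AEStronglyMeasurable (fun t => b t x) (volume.restrict (Icc 0 T))
  lipschitz : ∀ N : ℝ, ∃ L : ℝ≥0, ∀ t ∈ Icc 0 T, ∀ x y, ‖x‖ ≤ N → ‖y‖ ≤ N →
    ‖b t x - b t y‖ ≤ L * supUpTo t (x - y)
  growth : ∃ (l : ℝ≥0) (b₀ : ℝ → ℝ), MemLp b₀ p (volume.restrict (Icc 0 T)) ∧
    ∀ t ∈ Icc 0 T, ∀ x, ‖b t x‖ ≤ l * supUpTo t x + b₀ t

variable {p : ℝ≥0∞} {b : ℝ → C(Icc a T, E) → E}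

lemma RegularDrift.memLp (hb : RegularDrift p b) (x : C(Icc a T, E)) :
    MemLp (fun t => b t x) p (volume.restrict (Icc 0 T)) := by
  obtain ⟨l, b₀, hb₀, hle⟩ := hb.growth
  refine ((memLp_const (l * ‖x‖)).add hb₀).mono' (hb.aestronglyMeasurable x)
    (ae_restrict_of_forall_mem measurableSet_Icc fun t ht => (hle t ht x).trans ?_)
  simp only [Pi.add_apply]
  gcongr
  exact supUpTo_le (norm_nonneg x) fun s _ => x.norm_coe_le_norm s

lemma RegularDrift.intervalIntegrable (hb : RegularDrift p b) (hp : 1 ≤ p) (x : C(Icc a T, E))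
    {t : ℝ} (ht : t ∈ Icc 0 T) : IntervalIntegrable (fun s => b s x) volume 0 t :=
  (IntegrableOn.mono_set ((hb.memLp x).integrable hp)
    (uIcc_subset_Icc ⟨le_rfl, ht.1.trans ht.2⟩ ht)).intervalIntegrable

variable [NormedSpace ℝ E]

/-- The drift integral `∫_0^t b(s,x) ds`, extended by `0` to negative times. -/
def driftIntegral (b : ℝ → C(Icc a T, E) → E) (x : C(Icc a T, E)) (t : ℝ) : E :=
  ∫ s in (0 : ℝ)..max t 0, b s x

lemma driftIntegral_of_nonpos (x : C(Icc a T, E)) {t : ℝ} (ht : t ≤ 0) :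
    driftIntegral b x t = 0 := by
  rw [driftIntegral, max_eq_right ht, intervalIntegral.integral_same]

lemma mapsTo_max_zero (hT : 0 ≤ T) : MapsTo (max · 0) (Icc a T) (Icc 0 T) :=
  fun _ ht => ⟨le_max_right _ _, max_le ht.2 hT⟩

lemma RegularDrift.continuous_driftIntegral (hb : RegularDrift p b) (hp : 1 ≤ p) (hT : 0 ≤ T)
    (x : C(Icc a T, E)) : Continuous fun t : Icc a T => driftIntegral b x t := by
  have h : ContinuousOn (fun t => ∫ s in (0 : ℝ)..t, b s x) (Icc 0 T) := by
    rw [← uIcc_of_le hT]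
    refine intervalIntegral.continuousOn_primitive_interval ?_
    rw [uIcc_of_le hT]
    exact (hb.memLp x).integrable hp
  exact h.comp_continuous (by fun_prop) fun t => mapsTo_max_zero hT t.2

lemma RegularDrift.holderOn_driftIntegral (hb : RegularDrift p b) (hp : 1 ≤ p) (hT : 0 ≤ T)
    (x : C(Icc a T, E)) : HolderOn (1 - p.toReal⁻¹) (driftIntegral b x) (Icc a T) :=
  (holderOn_primitive_of_memLp hp ⟨le_rfl, hT⟩ (hb.memLp x)).comp_lipschitz
    (LipschitzWith.id.max_const 0).lipschitzOnWith (mapsTo_max_zero hT)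

lemma RegularDrift.norm_driftIntegral_sub_le (hb : RegularDrift p b) (hp : 1 ≤ p) (hT : 0 ≤ T)
    {x y : C(Icc a T, E)} {L : ℝ≥0} {A τ : ℝ} (hA : 0 ≤ A) (n : ℕ)
    (hlip : ∀ t ∈ Icc 0 T, ‖b t x - b t y‖ ≤ L * supUpTo t (x - y))
    (h : ∀ t : Icc a T, (t : ℝ) ≤ τ → ‖x t - y t‖ ≤ (L * max (t : ℝ) 0) ^ n / n.factorial * A)
    (t : Icc a T) (ht : (t : ℝ) ≤ τ) :
    ‖driftIntegral b x t - driftIntegral b y t‖ ≤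
      (L * max (t : ℝ) 0) ^ (n + 1) / (n + 1).factorial * A := by
  have htT : max (t : ℝ) 0 ∈ Icc 0 T := mapsTo_max_zero hT t.2
  rw [driftIntegral, driftIntegral, ← intervalIntegral.integral_sub
    (hb.intervalIntegrable hp x htT) (hb.intervalIntegrable hp y htT)]
  calc ‖∫ s in (0 : ℝ)..max (t : ℝ) 0, (b s x - b s y)‖
      ≤ ∫ s in (0 : ℝ)..max (t : ℝ) 0, L * ((L * s) ^ n / n.factorial * A) := by
        refine intervalIntegral.norm_integral_le_of_norm_le htT.1
          (Eventually.of_forall fun s hs => ?_)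
          (Continuous.intervalIntegrable (by fun_prop) _ _)
        have hs0 := hs.1.le
        have hst : s ≤ t := (le_max_iff.1 hs.2).resolve_right hs.1.not_ge
        refine (hlip s ⟨hs0, hst.trans t.2.2⟩).trans (by
          gcongr
          refine supUpTo_le (by positivity) fun u hu => (h u (hu.trans (hst.trans ht))).trans ?_
          gcongr
          exact max_le hu hs0)
    _ = _ := by
        simp only [mul_pow, intervalIntegral.integral_const_mul,
          intervalIntegral.integral_mul_const, intervalIntegral.integral_div, integral_pow,
          Nat.factorial_succ]
        push_cast
        field_simp
        ring

lemma norm_driftIntegral_le {l : ℝ≥0} {b₀ : ℝ → ℝ} {C : ℝ} (hT : 0 ≤ T) (hC : 0 ≤ C)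
    (hb₀ : IntegrableOn b₀ (Icc 0 T)) (hnonneg : ∀ t ∈ Icc 0 T, 0 ≤ b₀ t) {x : C(Icc a T, E)}
    (hle : ∀ t ∈ Icc 0 T, ‖b t x‖ ≤ l * supUpTo t x + b₀ t)
    (hx : ∀ t : Icc a T, ‖x t‖ ≤ C * Real.exp (l * max (t : ℝ) 0)) (t : Icc a T) :
    ‖driftIntegral b x t‖ ≤ C * (Real.exp (l * max (t : ℝ) 0) - 1) + ∫ s in Icc 0 T, b₀ s := by
  have hτ : max (t : ℝ) 0 ∈ Icc 0 T := mapsTo_max_zero hT t.2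
  rw [driftIntegral]
  set τ := max (t : ℝ) 0
  have hsub : Icc 0 τ ⊆ Icc 0 T := Icc_subset_Icc_right hτ.2
  have hint : IntervalIntegrable b₀ volume 0 τ :=
    (hb₀.mono_set ((uIcc_of_le hτ.1).trans_subset hsub)).intervalIntegrable
  have hexp : ∀ s, HasDerivAt (fun s => C * Real.exp (l * s)) (l * (C * Real.exp (l * s))) s :=
    fun s => ((((hasDerivAt_id s).const_mul (l : ℝ)).exp).const_mul C).congr_deriv (by
      simp only [id]; ring)
  have hexp_int : IntervalIntegrable (fun s => l * (C * Real.exp (l * s))) volume 0 τ :=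
    Continuous.intervalIntegrable (by fun_prop) _ _
  calc ‖∫ s in (0 : ℝ)..τ, b s x‖ ≤ ∫ s in (0 : ℝ)..τ, (l * (C * Real.exp (l * s)) + b₀ s) := by
        refine intervalIntegral.norm_integral_le_of_norm_le hτ.1
          (Eventually.of_forall fun s hs => ?_) (hexp_int.add hint)
        have hs0 := hs.1.le
        refine (hle s (hsub ⟨hs0, hs.2⟩)).trans (by
          gcongr
          refine supUpTo_le (by positivity) fun u hu => (hx u).trans ?_
          gcongr
          exact max_le hu hs0)
    _ = C * (Real.exp (l * τ) - 1) + ∫ s in Ioc 0 τ, b₀ s := by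
        rw [intervalIntegral.integral_add hexp_int hint,
          intervalIntegral.integral_eq_sub_of_hasDerivAt (fun s _ => hexp s) hexp_int,
          intervalIntegral.integral_of_le hτ.1]
        simp [mul_sub]
    _ ≤ _ := add_le_add le_rfl <|
        setIntegral_mono_set hb₀ (ae_restrict_of_forall_mem measurableSet_Icc hnonneg)
          (Ioc_subset_Icc_self.trans hsub).eventuallyLE

/-- The path `x` satisfies `x(t) = z(t) + ∫_0^t b(s,x) ds` for all `t ≤ τ`. -/
def SolvesUpTo (b : ℝ → C(Icc a T, E) → E) (z : ℝ → E) (τ : ℝ) (x : C(Icc a T, E)) : Prop :=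
  ∀ t : Icc a T, (t : ℝ) ≤ τ → x t = z t + driftIntegral b x t

lemma RegularDrift.eq_of_solvesUpTo (hb : RegularDrift p b) (hp : 1 ≤ p) (hT : 0 ≤ T)
    {z : ℝ → E} {τ : ℝ} {x y : C(Icc a T, E)} (hx : SolvesUpTo b z τ x) (hy : SolvesUpTo b z τ y)
    (t : Icc a T) (ht : (t : ℝ) ≤ τ) : x t = y t := by
  obtain ⟨L, hL⟩ := hb.lipschitz (max ‖x‖ ‖y‖)
  have key : ∀ n : ℕ, ∀ t : Icc a T, (t : ℝ) ≤ τ →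
      ‖x t - y t‖ ≤ (L * max (t : ℝ) 0) ^ n / n.factorial * ‖x - y‖ := by
    intro n
    induction n with
    | zero => exact fun t _ => by simpa using (x - y).norm_coe_le_norm t
    | succ n ih =>
      intro t ht
      rw [hx t ht, hy t ht, add_sub_add_left_eq_sub]
      exact hb.norm_driftIntegral_sub_le hp hT (norm_nonneg _) n
        (fun s hs => hL s hs x y (le_max_left _ _) (le_max_right _ _)) ih t ht
  have hlim := (FloorSemiring.tendsto_pow_div_factorial_atTop
    (L * max (t : ℝ) 0)).mul_const ‖x - y‖
  rw [zero_mul] at hlim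
  exact sub_eq_zero.1 (norm_le_zero_iff.1 (ge_of_tendsto' hlim fun n => key n t ht))

/-- The Picard operator `x ↦ z + ∫_0^· b(s,x) ds`. -/
def RegularDrift.picard (hb : RegularDrift p b) (hp : 1 ≤ p) (hT : 0 ≤ T) (z x : C(Icc a T, E)) :
    C(Icc a T, E) :=
  z + ⟨fun t => driftIntegral b x t, hb.continuous_driftIntegral hp hT x⟩

lemma RegularDrift.dist_picard_iterate_le (hb : RegularDrift p b) (hp : 1 ≤ p) (hT : 0 ≤ T)
    {z : C(Icc a T, E)} {s : Set C(Icc a T, E)} (hs : MapsTo (hb.picard hp hT z) s s) {L : ℝ≥0}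
    (hL : ∀ t ∈ Icc 0 T, ∀ x ∈ s, ∀ y ∈ s, ‖b t x - b t y‖ ≤ L * supUpTo t (x - y)) (n : ℕ)
    {x y : C(Icc a T, E)} (hx : x ∈ s) (hy : y ∈ s) :
    dist ((hb.picard hp hT z)^[n] x) ((hb.picard hp hT z)^[n] y) ≤
      (L * T) ^ n / n.factorial * dist x y := by
  have key : ∀ n, ∀ t : Icc a T,
      ‖(hb.picard hp hT z)^[n] x t - (hb.picard hp hT z)^[n] y t‖ ≤
        (L * max (t : ℝ) 0) ^ n / n.factorial * ‖x - y‖ := by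
    intro n
    induction n with
    | zero => exact fun t => by simpa using (x - y).norm_coe_le_norm t
    | succ n ih =>
      intro t
      rw [Function.iterate_succ_apply', Function.iterate_succ_apply']
      simp only [picard, ContinuousMap.add_apply, ContinuousMap.coe_mk, add_sub_add_left_eq_sub]
      exact hb.norm_driftIntegral_sub_le hp hT (norm_nonneg _) n
        (fun u hu => hL u hu _ (hs.iterate n hx) _ (hs.iterate n hy)) (fun t _ => ih t) t le_rfl
  rw [ContinuousMap.dist_le (by positivity)]
  intro t
  rw [dist_eq_norm, dist_eq_norm]
  refine (key n t).trans ?_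
  gcongr
  exact (mapsTo_max_zero hT t.2).2

lemma RegularDrift.exists_mapsTo_picard (hb : RegularDrift p b) (hp : 1 ≤ p) (hT : 0 ≤ T)
    (z : C(Icc a T, E)) :
    ∃ (s : Set C(Icc a T, E)) (N : ℝ), IsClosed s ∧ s.Nonempty ∧
      MapsTo (hb.picard hp hT z) s s ∧ ∀ x ∈ s, ‖x‖ ≤ N := by
  obtain ⟨l, b₀, hb₀, hle⟩ := hb.growth
  have hnonneg : ∀ t ∈ Icc 0 T, 0 ≤ b₀ t := fun t ht => by
    have hsup : supUpTo t (0 : C(Icc a T, E)) ≤ 0 := supUpTo_le le_rfl fun s _ => by simp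
    have := (norm_nonneg _).trans (hle t ht 0)
    have := mul_nonpos_of_nonneg_of_nonpos l.coe_nonneg hsup
    linarith
  set C := ‖z‖ + ∫ t in Icc 0 T, b₀ t with hC
  have hC0 : 0 ≤ C :=
    add_nonneg (norm_nonneg z) (setIntegral_nonneg measurableSet_Icc hnonneg)
  refine ⟨{x | ∀ t : Icc a T, ‖x t‖ ≤ C * Real.exp (l * max (t : ℝ) 0)},
    C * Real.exp (l * T), ?_, ⟨0, fun t => ?_⟩, fun x hx t => ?_, fun x hx => ?_⟩
  · simp only [ofPred_forall]
    exact isClosed_iInter fun t => isClosed_le (by fun_prop) continuous_const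
  · simpa using mul_nonneg hC0 (Real.exp_nonneg _)
  · have hdrift := norm_driftIntegral_le hT hC0 (hb₀.integrable hp) hnonneg
      (fun t ht => hle t ht x) hx t
    have hz := z.norm_coe_le_norm t
    refine (norm_add_le _ _).trans ((add_le_add hz hdrift).trans_eq ?_)
    rw [hC]; ring
  · refine (ContinuousMap.norm_le _ (by positivity)).2 fun t => (hx t).trans ?_
    gcongr
    exact (mapsTo_max_zero hT t.2).2

lemma RegularDrift.exists_solvesUpTo [CompleteSpace E] (hb : RegularDrift p b) (hp : 1 ≤ p)
    (hT : 0 ≤ T) {z : ℝ → E} (hz : ContinuousOn z (Icc a T)) :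
    ∃ x : C(Icc a T, E), SolvesUpTo b z T x := by
  set ζ : C(Icc a T, E) := ⟨fun t => z t, continuousOn_iff_continuous_domRestrict.1 hz⟩
  obtain ⟨s, N, hs, hne, hmaps, hN⟩ := hb.exists_mapsTo_picard hp hT ζ
  obtain ⟨L, hL⟩ := hb.lipschitz N
  obtain ⟨x, -, hx⟩ := exists_isFixedPt_of_dist_iterate_le hs.isComplete hne hmaps
    (FloorSemiring.tendsto_pow_div_factorial_atTop (L * T : ℝ)) fun n x hx y hy =>
      hb.dist_picard_iterate_le hp hT hmaps
        (fun t ht x hx y hy => hL t ht x y (hN x hx) (hN y hy)) n hx hy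
  exact ⟨x, fun t _ => (DFunLike.congr_fun hx t).symm⟩

end Forced

/-! ### The delay equation -/

lemma one_le_ofReal_one_div {α : ℝ} (hα : 0 < α) (hα' : α ≤ 1) : 1 ≤ ENNReal.ofReal (1 / α) :=
  ENNReal.one_le_ofReal.2 ((one_le_div hα).2 hα')

section Delay

variable {d m : ℕ} {r T α β : ℝ} {h : -r ≤ T} {p : ℝ≥0∞}
  {b : ℝ → C(Icc (-r) T, EuclideanSpace ℝ (Fin d)) → EuclideanSpace ℝ (Fin d)}
  {σ : ℝ → EuclideanSpace ℝ (Fin d) → EuclideanSpace ℝ (Fin d × Fin m)}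
  {g : ℝ → EuclideanSpace ℝ (Fin m)} {η : ℝ → EuclideanSpace ℝ (Fin d)}
  {x y : C(Icc (-r) T, EuclideanSpace ℝ (Fin d))}

/-- The integrand `s ↦ σ(s, x(s-r))` of the diffusion term. -/
def delayedDiffusion (h : -r ≤ T)
    (σ : ℝ → EuclideanSpace ℝ (Fin d) → EuclideanSpace ℝ (Fin d × Fin m))
    (x : C(Icc (-r) T, EuclideanSpace ℝ (Fin d))) (s : ℝ) : EuclideanSpace ℝ (Fin d × Fin m) :=
  σ s (IccExtend h x (s - r))

/-- The part of the equation that depends on the path only through its delayed values: the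
initial path, frozen after time `0`, plus the diffusion integral, started at time `0`. -/
def forcing (h : -r ≤ T) (α : ℝ)
    (σ : ℝ → EuclideanSpace ℝ (Fin d) → EuclideanSpace ℝ (Fin d × Fin m))
    (g : ℝ → EuclideanSpace ℝ (Fin m)) (η : ℝ → EuclideanSpace ℝ (Fin d))
    (x : C(Icc (-r) T, EuclideanSpace ℝ (Fin d))) (t : ℝ) : EuclideanSpace ℝ (Fin d) :=
  η (min t 0) + matrixStieltjesTo α T (delayedDiffusion h σ x) g (max t 0)

lemma forcing_of_nonpos {t : ℝ} (ht : t ≤ 0) : forcing h α σ g η x t = η t := by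
  rw [forcing, min_eq_left ht, max_eq_right ht, matrixStieltjesTo_zero, add_zero]

lemma forcing_of_nonneg {t : ℝ} (ht : 0 ≤ t) :
    forcing h α σ g η x t = η 0 + matrixStieltjesTo α T (delayedDiffusion h σ x) g t := by
  rw [forcing, min_eq_right ht, max_eq_left ht]

lemma forcing_congr (hr : 0 ≤ r) {τ : ℝ} (hxy : ∀ s : Icc (-r) T, (s : ℝ) ≤ τ → x s = y s)
    {t : ℝ} (htT : t ≤ T) (htτ : t ≤ τ + r) :
    forcing h α σ g η x t = forcing h α σ g η y t := by
  refine congrArg (η (min t 0) + ·) (matrixStieltjesTo_congr fun s hs => ?_)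
  have hst : s < t := (lt_max_iff.1 hs.2).resolve_right hs.1.not_gt
  have hs' : s - r ∈ Icc (-r) T := ⟨by linarith [hs.1], by linarith⟩
  rw [delayedDiffusion, delayedDiffusion, IccExtend_of_mem h x hs', IccExtend_of_mem h y hs',
    hxy ⟨s - r, hs'⟩ (by simp only; linarith)]

lemma RegularCoefficient.holderOn_delayedDiffusion (hσ : RegularCoefficient T β σ) (hr : 0 ≤ r)
    {μ : ℝ} (hμ : 0 < μ) (hx : HolderOn μ (IccExtend h x) (Icc (-r) T)) :
    HolderOn (min β μ) (delayedDiffusion h σ x) (Icc 0 T) :=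
  hσ.holderOn_comp hμ <| hx.comp_lipschitz
    (LipschitzWith.of_dist_le_mul (K := 1) fun s t => by
      simp [Real.dist_eq]).lipschitzOnWith
    fun s hs => ⟨by linarith [hs.1], by linarith [hs.2]⟩

lemma RegularCoefficient.holderOn_forcing (hσ : RegularCoefficient T β σ) (hr : 0 ≤ r)
    (hT : 0 ≤ T) (hα : 0 < α) (hα' : α < 1 / 2) (hαβ : α < β) (hg : MemWT α T g)
    (hη : HolderOn (1 - α) η (Icc (-r) 0)) (hx : HolderOn (1 - α) (IccExtend h x) (Icc (-r) T)) :
    HolderOn (1 - α) (forcing h α σ g η x) (Icc (-r) T) := by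
  have hdiff := hσ.holderOn_delayedDiffusion hr (by linarith) hx
  refine HolderOn.add
    (hη.comp_lipschitz (φ := (min · 0)) (LipschitzWith.id.min_const 0).lipschitzOnWith
      fun t ht => ⟨le_min ht.1 (by linarith), min_le_right _ _⟩)
    ((hdiff.matrixStieltjesTo ⟨hα, by linarith⟩ (lt_min hαβ (by linarith)) hT hg).comp_lipschitz
      (LipschitzWith.id.max_const 0).lipschitzOnWith (mapsTo_max_zero hT))

lemma IsSolution.solvesUpTo (hx : IsSolution h α b σ g η x) (τ : ℝ) :
    SolvesUpTo b (forcing h α σ g η x) τ x := by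
  intro t _
  rw [← IccExtend_val h x t]
  rcases le_or_gt (t : ℝ) 0 with ht | ht
  · rw [forcing_of_nonpos ht, driftIntegral_of_nonpos x ht, add_zero]
    exact hx.initial t ⟨t.2.1, ht⟩
  · rw [forcing_of_nonneg ht.le, driftIntegral, max_eq_left ht.le, add_right_comm]
    exact hx.equation t ⟨ht, t.2.2⟩

lemma isSolution_of_solvesUpTo (hr : 0 ≤ r) (hT : 0 ≤ T) (hα : 0 < α) (hα' : α < 1 / 2)
    (hαβ : α < β) (hσ : RegularCoefficient T β σ) (hb : RegularDrift p b) (hp : 1 ≤ p)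
    (hxh : HolderOn (1 - α) (IccExtend h x) (Icc (-r) T))
    (hx : SolvesUpTo b (forcing h α σ g η x) T x) : IsSolution h α b σ g η x where
  integrable_drift := (hb.memLp x).integrable hp
  memW1_diffusion t ht i j :=
    ((hσ.holderOn_delayedDiffusion hr (by linarith) hxh).euclidean_apply (i, j)).memW1_indicator_Ioo
      ⟨hα, by linarith⟩ (lt_min hαβ (by linarith)) ⟨ht.1.le, ht.2⟩
  equation t ht := by
    rw [IccExtend_of_mem h x ⟨by linarith [ht.1], ht.2⟩, hx _ ht.2, forcing_of_nonneg ht.1.le,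
      driftIntegral, max_eq_left ht.1.le, add_right_comm]
    rfl
  initial t ht := by
    rw [IccExtend_of_mem h x ⟨ht.1, ht.2.trans hT⟩, hx _ (ht.2.trans hT), forcing_of_nonpos ht.2,
      driftIntegral_of_nonpos x ht.2, add_zero]

lemma RegularDrift.exists_holderOn_solvesUpTo (hα : 0 < α) (hα' : α < 1)
    (hb : RegularDrift (ENNReal.ofReal (1 / α)) b) (hT : 0 ≤ T) {z : ℝ → EuclideanSpace ℝ (Fin d)}
    (hz : HolderOn (1 - α) z (Icc (-r) T)) :
    ∃ x : C(Icc (-r) T, EuclideanSpace ℝ (Fin d)),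
      HolderOn (1 - α) (IccExtend h x) (Icc (-r) T) ∧ SolvesUpTo b z T x := by
  have hp := one_le_ofReal_one_div hα hα'.le
  obtain ⟨x, hx⟩ := hb.exists_solvesUpTo hp hT (hz.continuousOn (sub_pos.2 hα'))
  have hdrift := hb.holderOn_driftIntegral hp hT x
  rw [ENNReal.toReal_ofReal (by positivity), one_div, inv_inv] at hdrift
  refine ⟨x, (hz.add hdrift).congr fun t ht => ?_, hx⟩
  rw [IccExtend_of_mem h x ht]
  exact hx ⟨t, ht⟩ ht.2

lemma delay_induction {P : ℝ → Prop} (hr : 0 < r) (hP : Antitone P) {τ₀ : ℝ} (h₀ : P τ₀)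
    (hstep : ∀ τ, P τ → P (τ + r)) (τ : ℝ) : P τ := by
  have hP_nat : ∀ n : ℕ, P (τ₀ + n * r) := fun n => by
    induction n with
    | zero => simpa using h₀
    | succ n ih => simpa [add_mul, add_assoc] using hstep _ ih
  obtain ⟨n, hn⟩ := exists_nat_ge ((τ - τ₀) / r)
  exact hP (by linarith [(div_le_iff₀ hr).1 hn]) (hP_nat n)

lemma exists_solvesUpTo_forcing (hr : 0 < r) (hT : 0 ≤ T) (hα : 0 < α) (hα' : α < 1 / 2)
    (hαβ : α < β) (hσ : RegularCoefficient T β σ) (hb : RegularDrift (ENNReal.ofReal (1 / α)) b)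
    (hg : MemWT α T g) (hη : HolderOn (1 - α) η (Icc (-r) 0)) :
    ∃ x : C(Icc (-r) T, EuclideanSpace ℝ (Fin d)),
      HolderOn (1 - α) (IccExtend h x) (Icc (-r) T) ∧
        SolvesUpTo b (forcing h α σ g η x) T x := by
  refine delay_induction (P := fun τ => ∃ x : C(Icc (-r) T, EuclideanSpace ℝ (Fin d)),
    HolderOn (1 - α) (IccExtend h x) (Icc (-r) T) ∧ SolvesUpTo b (forcing h α σ g η x) τ x)
    hr ?_ (τ₀ := -r - 1) ?_ ?_ T
  · rintro τ τ' hτ ⟨x, hxh, hx⟩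
    exact ⟨x, hxh, fun t ht => hx t (ht.trans hτ)⟩
  · exact ⟨0, ⟨0, fun s _ t _ => by simp [IccExtend]⟩, fun t ht => by linarith [t.2.1]⟩
  · rintro τ ⟨x, hxh, hx⟩
    -- `x` already has the right forcing up to `τ + r`; solving with it fixes the drift there too.
    have hforcing := hσ.holderOn_forcing hr.le hT hα hα' hαβ hg hη hxh
    obtain ⟨y, hyh, hy⟩ := hb.exists_holderOn_solvesUpTo (h := h) hα (by linarith) hT hforcing
    have hyx := hb.eq_of_solvesUpTo (one_le_ofReal_one_div hα (by linarith)) hT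
      (fun t _ => hy t t.2.2) hx
    refine ⟨y, hyh, fun t ht => ?_⟩
    rw [forcing_congr hr.le hyx t.2.2 ht]
    exact hy t t.2.2

lemma eq_of_solvesUpTo_forcing (hr : 0 < r) (hT : 0 ≤ T) (hb : RegularDrift p b) (hp : 1 ≤ p)
    (hx : SolvesUpTo b (forcing h α σ g η x) T x) (hy : SolvesUpTo b (forcing h α σ g η y) T y) :
    x = y := by
  have key : ∀ τ, ∀ t : Icc (-r) T, (t : ℝ) ≤ τ → x t = y t := by
    refine delay_induction hr (fun τ τ' hτ hxy t ht => hxy t (ht.trans hτ)) (τ₀ := -r - 1)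
      (fun t ht => by linarith [t.2.1]) fun τ hxy => ?_
    refine hb.eq_of_solvesUpTo hp hT (fun t _ => hx t t.2.2) fun t ht => ?_
    rw [forcing_congr hr.le hxy t.2.2 ht]
    exact hy t t.2.2
  exact ContinuousMap.ext fun t => key T t t.2.2

lemma HypH1.regularCoefficient {δ : ℝ} (hσ : HypH1 T β δ σ) : RegularCoefficient T β σ := by
  obtain ⟨M, hM, hlip, -, hhol⟩ := hσ.bounds
  have hM0 := (hM 0 le_rfl).le
  refine ⟨fun N => ⟨(M 0).toNNReal, fun t ht => LipschitzOnWith.of_dist_le_mul fun x _ y _ => ?_⟩,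
    fun N => ⟨(M 0).toNNReal, fun x _ => ?_⟩⟩
  · simpa [dist_eq_norm, Real.coe_toNNReal _ hM0] using hlip t ht x y
  rcases isEmpty_or_nonempty (Fin d) with hd | ⟨⟨i⟩⟩
  · exact fun t _ s _ => by simp [Subsingleton.elim (σ t x) (σ s x)]
  · intro t ht s hs
    have hts := (le_add_of_nonneg_right (norm_nonneg _)).trans (hhol t ht s hs x i)
    rw [edist_dist, edist_dist, dist_eq_norm, Real.dist_eq,
      Real.coe_toNNReal _ hσ.beta_mem.1.le,
      ENNReal.ofReal_rpow_of_nonneg (abs_nonneg _) hσ.beta_mem.1.le]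
    exact (ENNReal.ofReal_le_ofReal hts).trans_eq (ENNReal.ofReal_mul hM0)

lemma HypH2.regularDrift {ρ : ℝ} (hb : HypH2 r T ρ b) : RegularDrift (ENNReal.ofReal ρ) b := by
  obtain ⟨b₀, L, hb₀, hL, hlip, hgrowth⟩ := hb.bounds
  refine ⟨fun x => ?_, fun N => ⟨(L (max N 0)).toNNReal, fun t ht x y hx hy => ?_⟩,
    ⟨(L 0).toNNReal, b₀, hb₀, fun t ht x => ?_⟩⟩
  · let : MeasurableSpace C(Icc (-r) T, EuclideanSpace ℝ (Fin d)) := borel _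
    have hmeas : Measurable fun t : Icc 0 T => b t x :=
      hb.measurable.comp (measurable_id.prodMk measurable_const)
    exact (aemeasurable_restrict_of_measurable_subtype measurableSet_Icc hmeas).aestronglyMeasurable
  · rw [Real.coe_toNNReal _ (hL _ (le_max_right _ _)).le]
    exact hlip _ (le_max_right _ _) t ht x y (hx.trans (le_max_left _ _))
      (hy.trans (le_max_left _ _))
  · rw [Real.coe_toNNReal _ (hL 0 le_rfl).le]
    exact hgrowth t ht x

end Delay

end DelayEq

end

theorem theorem3p1_general {d m : ℕ} (r T : ℝ) (hr : 0 < r) (hT : 0 ≤ T)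
    (α β : ℝ) (hα : 0 < α) (hα' : α < 1 / 2) (hαβ : α < β)
    (σ : ℝ → EuclideanSpace ℝ (Fin d) → EuclideanSpace ℝ (Fin d × Fin m))
    (hσ : DelayEq.RegularCoefficient T β σ)
    (b : ℝ → C(Set.Icc (-r) T, EuclideanSpace ℝ (Fin d)) → EuclideanSpace ℝ (Fin d))
    (hb : DelayEq.RegularDrift (ENNReal.ofReal (1 / α)) b)
    (g : ℝ → EuclideanSpace ℝ (Fin m)) (hg : DelayEq.MemWT α T g)
    (η : ℝ → EuclideanSpace ℝ (Fin d)) (hη : DelayEq.MemHolder (1 - α) (-r) 0 η) :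
    ∃ x : C(Set.Icc (-r) T, EuclideanSpace ℝ (Fin d)),
      (DelayEq.MemW α (-r) T (Set.IccExtend (by linarith : -r ≤ T) x) ∧
        DelayEq.MemHolder (1 - α) (-r) T (Set.IccExtend (by linarith : -r ≤ T) x) ∧
        DelayEq.IsSolution (by linarith : -r ≤ T) α b σ g η x) ∧
      ∀ y, DelayEq.IsSolution (by linarith : -r ≤ T) α b σ g η y → y = x := by
  have hη_holder := (DelayEq.memHolder_iff (by linarith)).1 hη
  have hp := DelayEq.one_le_ofReal_one_div hα (by linarith)
  obtain ⟨x, hx_holder, hx⟩ := DelayEq.exists_solvesUpTo_forcing (h := by linarith)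
    hr hT hα hα' hαβ hσ hb hg hη_holder
  refine ⟨x, ⟨hx_holder.memW hα.le (by linarith),
    (DelayEq.memHolder_iff (by linarith)).2 hx_holder,
    DelayEq.isSolution_of_solvesUpTo hr.le hT hα hα' hαβ hσ hb hp hx_holder hx⟩, fun y hy => ?_⟩
  exact DelayEq.eq_of_solvesUpTo_forcing hr hT hb hp (hy.solvesUpTo T) hx

theorem theorem3p1 {d m : ℕ} (r T : ℝ) (hr : 0 < r) (hT : 0 < T)
    (α β δ : ℝ) (hα : 0 < α) (hα₀ : α < min (1 / 2) (min β (δ / (1 + δ))))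
    (σ : ℝ → EuclideanSpace ℝ (Fin d) → EuclideanSpace ℝ (Fin d × Fin m))
    (hσ : DelayEq.HypH1 T β δ σ)
    (b : ℝ → C(Set.Icc (-r) T, EuclideanSpace ℝ (Fin d)) → EuclideanSpace ℝ (Fin d))
    (hb : DelayEq.HypH2 r T (1 / α) b)
    (g : ℝ → EuclideanSpace ℝ (Fin m)) (hg : DelayEq.MemWT α T g)
    (η : ℝ → EuclideanSpace ℝ (Fin d))
    (hη : DelayEq.MemW α (-r) 0 η) (hη' : DelayEq.MemHolder (1 - α) (-r) 0 η) :
    ∃! x : C(Set.Icc (-r) T, EuclideanSpace ℝ (Fin d)),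
      DelayEq.MemW α (-r) T (Set.IccExtend (by linarith : -r ≤ T) x) ∧
      DelayEq.MemHolder (1 - α) (-r) T (Set.IccExtend (by linarith : -r ≤ T) x) ∧
      DelayEq.IsSolution (by linarith : -r ≤ T) α b σ g η x := by
  obtain ⟨hα_half, hαβ, -⟩ := lt_min_iff.1 hα₀ |>.imp_right lt_min_iff.1
  obtain ⟨x, hx, huniq⟩ := theorem3p1_general r T hr hT.le α β hα hα_half hαβ σ
    hσ.regularCoefficient b hb.regularDrift g hg η hη'
  exact ⟨x, hx, fun y hy => huniq y hy.2.2⟩
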